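/- **Setting.** Let $d\ge 1$, let $u:\mathbb R^d\to\mathbb R$ be differentiable, put $h=\nabla u$, and let $m,L,l>0$ be such that for all $x,y\in\mathbb R^d$ $$\langle h(x)-h(y),x-y\rangle\ge 2m|x-y|^2,\qquad |h(x)-h(y)|\le L(1+|x|+|y|)^l|x-y|.$$ For a step size $\lambda>0$ let $r_\lambda=(L+m)(1/\sqrt\lambda)^{1/(l+2)}$, $g(x)=h(x)-mx$, $R_\lambda=\sup_{B(0,r_\lambda)}|g|$, and define the tamed drift $h_\lambda(x)=t(x)g(x)+R_\lambda s(x)x+mx$, where $t(x)=1$ if $|x|\le r_\lambda-1$, $t(x)=r_\lambda-|x|$ if $r_\lambda-1<|x|<r_\lambda$, $t(x)=0$ if $|x|\ge r_\lambda$; and $s(x)=0$ if $|x|\le r_\lambda-2$, $s(x)=|x|-r_\lambda+2$ if $r_\lambda-2<|x|<r_\lambda-1$, $s(x)=1$ if $r_\lambda-1\le|x|\le r_\lambda$, $s(x)=r_\lambda/|x|$ if $|x|\ge r_\lambda$ (earlier cases take precedence). Let $M_\lambda$ be the (smallest) Lipschitz constant of $h_\lambda$. For $\gamma>0$ let $\psi_0(t)=e^{-\gamma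 t}$, $\psi_1(t)=\frac{1-e^{-\gamma t}}{\gamma}$, $\psi_2(t)=\frac{\gamma t+e^{-\gamma t}-1}{\gamma^2}$. The tamed stochastic exponential scheme started at $(\theta_0,v_0)$ is $$v_{n+1}=\psi_0(\lambda)v_n-\psi_1(\lambda)h_\lambda(\theta_n)+\sqrt{2\gamma}\,\Xi_{n+1},\qquad \theta_{n+1}=\theta_n+\psi_1(\lambda)v_n-\psi_2(\lambda)h_\lambda(\theta_n)+\sqrt{2\gamma}\,\Xi'_{n+1},$$ where the pairs $(\Xi_j,\Xi'_j)_{j\ge1}$ are i.i.d. and independent of $(\theta_0,v_0)$, and for each $j$ the coordinate pairs $((\Xi_j)_i,(\Xi'_j)_i)$, $1\le i\le d$, are i.i.d. centered Gaussian vectors in $\mathbb R^2$ with covariance matrix $\int_0^\lambda(\psi_0(t),\psi_1(t))^\top(\psi_0(t),\psi_1(t))\,dt$. A probability measure $\mu$ on a Euclidean space satisfies a log-Sobolev inequality (LSI) with constant $C$ if $$\int f^2\log f^2\,d\mu-\Big(\int f^2d\mu\Big)\log\Big(\int f^2d\mu\Big)\le 2C\int|\nabla f|^2d\mu$$ for all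 bounded $C^1$ functions $f$ with bounded gradient. Let $M(x,v)=(x,x+\frac2\gamma v)$, a map into $\mathbb R^{2d}$ with its Euclidean norm. **Theorem.** There are absolute constants $c_0>0$ and $K\ge0$ such that in the above setting, whenever $\gamma\ge5\sqrt{M_\lambda}$, $0<\lambda\le\frac1{2\gamma}$, and the law of $M(\theta_0,v_0)$ satisfies an LSI with constant $C_{LSI,0}$, then for every $n\ge0$ the law of $M(\theta_n,v_n)$ satisfies an LSI with a constant $$C_{LSI,n}\le\Big(1-\frac{c_0m}{\gamma}\lambda\Big)^nC_{LSI,0}+\frac1{c_0m}+K\lambda\gamma .$$ -/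

import Mathlib

open MeasureTheory ProbabilityTheory

noncomputable section

namespace TamedKinetic

/-! ### Log-Sobolev inequality -/

/-- The entropy `Ent_μ(g) = ∫ g log g dμ - (∫ g dμ) log (∫ g dμ)`, with `0 log 0 = 0`. -/
def entropy {F : Type*} [MeasurableSpace F] (μ : Measure F) (g : F → ℝ) : ℝ :=
  (∫ z, g z * Real.log (g z) ∂μ) - (∫ z, g z ∂μ) * Real.log (∫ z, g z ∂μ)

/-- `μ` satisfies a log-Sobolev inequality with constant `C`:
`Ent_μ(f²) ≤ 2 C ∫ |∇f|² dμ` for every bounded `C¹` function `f` with bounded gradient.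
In this normalization the constant of a Gaussian law is the operator norm of its covariance.
For a probability measure `μ` all the integrals are finite. -/
def SatisfiesLSI {F : Type*} [NormedAddCommGroup F] [InnerProductSpace ℝ F] [CompleteSpace F]
    [MeasurableSpace F] (μ : Measure F) (C : ℝ) : Prop :=
  ∀ f : F → ℝ, ContDiff ℝ 1 f → (∃ B : ℝ, ∀ z, |f z| ≤ B) → (∃ B : ℝ, ∀ z, ‖gradient f z‖ ≤ B) →
    entropy μ (fun z => f z ^ 2) ≤ 2 * C * ∫ z, ‖gradient f z‖ ^ 2 ∂μ

/-! ### The assumptions on the drift -/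

section Drift

variable {d : ℕ}

/-- Strong monotonicity: `⟨h x - h y, x - y⟩ ≥ 2 m |x - y|²`. -/
def StronglyMonotone (h : EuclideanSpace ℝ (Fin d) → EuclideanSpace ℝ (Fin d)) (m : ℝ) : Prop :=
  ∀ x y, 2 * m * ‖x - y‖ ^ 2 ≤ inner ℝ (h x - h y) (x - y)

/-- Polynomial local Lipschitz continuity: `|h x - h y| ≤ L (1 + |x| + |y|)^l |x - y|`. -/
def PolyLipschitz (h : EuclideanSpace ℝ (Fin d) → EuclideanSpace ℝ (Fin d)) (L l : ℝ) : Prop :=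
  ∀ x y, ‖h x - h y‖ ≤ L * (1 + ‖x‖ + ‖y‖) ^ l * ‖x - y‖

/-! ### The tamed drift -/

/-- The radius `r_λ = (L + m) (1/√λ)^(1/(l+2))`. -/
def tameRadius (m L l lam : ℝ) : ℝ := (L + m) * (1 / √lam) ^ (1 / (l + 2))

/-- `g(x) = h(x) - m x`. -/
def shifted (h : EuclideanSpace ℝ (Fin d) → EuclideanSpace ℝ (Fin d)) (m : ℝ)
    (x : EuclideanSpace ℝ (Fin d)) : EuclideanSpace ℝ (Fin d) := h x - m • x

/-- `sup_{B(0,r)} |g|`. -/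
def supBall (g : EuclideanSpace ℝ (Fin d) → EuclideanSpace ℝ (Fin d)) (r : ℝ) : ℝ :=
  sSup ((fun x => ‖g x‖) '' Metric.ball 0 r)

/-- The cutoff `t`, as a function of `ρ = |x|`. -/
def cutoffT (r ρ : ℝ) : ℝ :=
  if ρ ≤ r - 1 then 1 else if ρ < r then r - ρ else 0

/-- The cutoff `s`, as a function of `ρ = |x|`. -/
def cutoffS (r ρ : ℝ) : ℝ :=
  if ρ ≤ r - 2 then 0 else if ρ < r - 1 then ρ - r + 2 else if ρ ≤ r then 1 else r / ρ

/-- The tamed drift `h_λ(x) = t(x) g(x) + R_λ s(x) x + m x`. -/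
def tamedDrift (h : EuclideanSpace ℝ (Fin d) → EuclideanSpace ℝ (Fin d)) (m L l lam : ℝ)
    (x : EuclideanSpace ℝ (Fin d)) : EuclideanSpace ℝ (Fin d) :=
  cutoffT (tameRadius m L l lam) ‖x‖ • shifted h m x
    + (supBall (shifted h m) (tameRadius m L l lam) * cutoffS (tameRadius m L l lam) ‖x‖) • x
    + m • x

/-- The (smallest) Lipschitz constant of a Lipschitz map. -/
def lipConst (f : EuclideanSpace ℝ (Fin d) → EuclideanSpace ℝ (Fin d)) : NNReal :=
  sInf {K : NNReal | LipschitzWith K f}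

end Drift

/-! ### The stochastic exponential scheme -/

/-- `ψ₀(t) = e^{-γt}`. -/
def psi0 (γ t : ℝ) : ℝ := Real.exp (-γ * t)

/-- `ψ₁(t) = ∫₀ᵗ ψ₀ = (1 - e^{-γt})/γ`. -/
def psi1 (γ t : ℝ) : ℝ := (1 - Real.exp (-γ * t)) / γ

/-- `ψ₂(t) = ∫₀ᵗ ψ₁ = (γt + e^{-γt} - 1)/γ²`. -/
def psi2 (γ t : ℝ) : ℝ := (γ * t + Real.exp (-γ * t) - 1) / γ ^ 2

/-- `∫₀^λ (ψ₀(t), ψ₁(t))ᵀ (ψ₀(t), ψ₁(t)) dt`. -/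
def noiseCov (γ lam : ℝ) : Matrix (Fin 2) (Fin 2) ℝ :=
  !![∫ t in (0 : ℝ)..lam, psi0 γ t * psi0 γ t, ∫ t in (0 : ℝ)..lam, psi0 γ t * psi1 γ t;
     ∫ t in (0 : ℝ)..lam, psi1 γ t * psi0 γ t, ∫ t in (0 : ℝ)..lam, psi1 γ t * psi1 γ t]

/-- The noise `(Ξ n, Ξ' n)` (used in the step from `n` to `n + 1`) and the initial condition
`(θ₀, V₀)` of the scheme: the noise vectors are independent in `n` and independent of the initial
condition, and for each `n` the coordinate pairs `(Ξ n ω i, Ξ' n ω i)`, `i < d`, are independent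
centered Gaussian vectors in the plane with covariance `noiseCov γ lam`. -/
structure IsSchemeInput {d : ℕ} {Ω : Type*} [MeasurableSpace Ω] (P : Measure Ω) (γ lam : ℝ)
    (θ₀ V₀ : Ω → EuclideanSpace ℝ (Fin d)) (Ξ Ξ' : ℕ → Ω → EuclideanSpace ℝ (Fin d)) : Prop where
  measurable_θ₀ : Measurable θ₀
  measurable_V₀ : Measurable V₀
  measurable_Ξ : ∀ n, Measurable (Ξ n)
  measurable_Ξ' : ∀ n, Measurable (Ξ' n)
  indep_init : IndepFun (fun ω => (θ₀ ω, V₀ ω)) (fun ω (n : ℕ) => (Ξ n ω, Ξ' n ω)) P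
  indep_steps : iIndepFun (fun (n : ℕ) ω => (Ξ n ω, Ξ' n ω)) P
  indep_coords : ∀ n, iIndepFun (fun (i : Fin d) ω => (Ξ n ω i, Ξ' n ω i)) P
  law_coords : ∀ (n : ℕ) (i : Fin d),
    HasLaw (fun ω => !₂[Ξ n ω i, Ξ' n ω i]) (multivariateGaussian 0 (noiseCov γ lam)) P

/-- The iterates `(θ_n, v_n)` of the stochastic exponential scheme with drift `b`, friction `γ` and
step size `lam`. -/
def expScheme {d : ℕ} {Ω : Type*}
    (b : EuclideanSpace ℝ (Fin d) → EuclideanSpace ℝ (Fin d)) (γ lam : ℝ)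
    (θ₀ V₀ : Ω → EuclideanSpace ℝ (Fin d)) (Ξ Ξ' : ℕ → Ω → EuclideanSpace ℝ (Fin d)) :
    ℕ → Ω → EuclideanSpace ℝ (Fin d) × EuclideanSpace ℝ (Fin d)
  | 0, ω => (θ₀ ω, V₀ ω)
  | n + 1, ω =>
    let z := expScheme b γ lam θ₀ V₀ Ξ Ξ' n ω
    (z.1 + psi1 γ lam • z.2 - psi2 γ lam • b z.1 + √(2 * γ) • Ξ' n ω,
     psi0 γ lam • z.2 - psi1 γ lam • b z.1 + √(2 * γ) • Ξ n ω)

/-- The change of coordinates `(x, v) ↦ (x, x + (2/γ) v)`, with values in `ℝ^{2d}` carrying the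
Euclidean norm `|(x, y)|² = |x|² + |y|²`. -/
def coordM {d : ℕ} (γ : ℝ) (z : EuclideanSpace ℝ (Fin d) × EuclideanSpace ℝ (Fin d)) :
    WithLp 2 (EuclideanSpace ℝ (Fin d) × EuclideanSpace ℝ (Fin d)) :=
  WithLp.toLp 2 (z.1, z.1 + (2 / γ) • z.2)

end TamedKinetic

end

/-!
The Gaussian log-Sobolev inequality on `ℝ` follows from the two-point inequality by tensorization
and the central limit theorem. Constants of log-Sobolev inequalities add under convolution, and a
`κ`-Lipschitz map multiplies them by `κ²`, as one sees by mollifying the map.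

In the coordinates `(x, x + (2/γ) v)` one step of the scheme is a deterministic map followed by an
independent Gaussian perturbation whose covariance is at most a multiple of `λ/γ`. The map contracts
with squared factor `1 - mλ/(5γ)`, because the tamed drift `b` is strongly monotone and cocoercive,
`|b x - b y|² ≤ 6 M_λ ⟨b x - b y, x - y⟩`. Cocoercivity is the delicate point: in the annulus where
the drift is tamed it is not a gradient, so the Baillon–Haddad theorem does not apply there. But
cocoercivity is a local property along segments, and off finitely many spheres the drift is locally
the sum of a cutoff multiple of a gradient field and a radial field, whose monotonicity dominates
the error from differentiating the cutoff.

The constants thus satisfy `C_{n+1} = (1 - mλ/(5γ)) C_n + 18 λ/γ`, a geometric recursion with fixed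
point `90/m`.
-/

namespace TamedKinetic

open Filter Topology ENNReal

/-! ### Entropy of bounded functions -/

lemma abs_mul_log_le {x : ℝ} (hx : 0 ≤ x) : |x * Real.log x| ≤ 1 + x ^ 2 := by
  rcases hx.eq_or_lt with rfl | hx
  · simp
  rcases le_total x 1 with h | h
  · rw [mul_comm]
    exact (Real.abs_log_mul_self_lt x hx h).le.trans (by nlinarith)
  · rw [abs_of_nonneg (mul_nonneg hx.le (Real.log_nonneg h))]
    nlinarith [Real.log_le_sub_one_of_pos hx]

lemma abs_mul_log_le_of_mem_Icc {x B : ℝ} (hx : x ∈ Set.Icc 0 B) :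
    |x * Real.log x| ≤ 1 + B ^ 2 :=
  (abs_mul_log_le hx.1).trans (by nlinarith [hx.1, hx.2])

section Entropy

variable {α β : Type*} [MeasurableSpace α] [MeasurableSpace β] {μ : Measure α}

lemma integral_mem_Icc [IsProbabilityMeasure μ] {g : α → ℝ} {a b : ℝ} (hg : Measurable g)
    (hab : ∀ z, g z ∈ Set.Icc a b) : ∫ z, g z ∂μ ∈ Set.Icc a b :=
  (convex_Icc a b).integral_mem isClosed_Icc (ae_of_all _ hab)
    (.of_mem_Icc a b hg.aemeasurable (ae_of_all _ hab))

lemma integrable_mul_log [IsFiniteMeasure μ] {g : α → ℝ} {B : ℝ} (hg : Measurable g)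
    (hB : ∀ z, g z ∈ Set.Icc 0 B) : Integrable (fun z => g z * Real.log (g z)) μ :=
  .of_bound (by fun_prop) (1 + B ^ 2) (ae_of_all _ fun z => abs_mul_log_le_of_mem_Icc (hB z))

lemma abs_entropy_le [IsProbabilityMeasure μ] {g : α → ℝ} {B : ℝ} (hg : Measurable g)
    (hB : ∀ z, g z ∈ Set.Icc 0 B) : |entropy μ g| ≤ 2 * (1 + B ^ 2) := by
  have hint : |∫ z, g z * Real.log (g z) ∂μ| ≤ 1 + B ^ 2 := by
    simpa using norm_integral_le_of_norm_le_const (μ := μ) (f := fun z => g z * Real.log (g z))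
      (ae_of_all _ fun z => abs_mul_log_le_of_mem_Icc (hB z))
  have hmean := abs_mul_log_le_of_mem_Icc (integral_mem_Icc (μ := μ) hg hB)
  exact (abs_sub _ _).trans (by linarith)

lemma entropy_nonneg [IsProbabilityMeasure μ] {g : α → ℝ} {B : ℝ} (hg : Measurable g)
    (hB : ∀ z, g z ∈ Set.Icc 0 B) : 0 ≤ entropy μ g :=
  sub_nonneg.2 <| Real.convexOn_mul_log.map_integral_le Real.continuous_mul_log.continuousOn
    isClosed_Ici (ae_of_all _ fun z => (hB z).1)
    (.of_mem_Icc 0 B hg.aemeasurable (ae_of_all _ hB)) (integrable_mul_log hg hB)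

lemma entropy_map {φ : α → β} (hφ : Measurable φ) {g : β → ℝ} (hg : Measurable g) :
    entropy (μ.map φ) g = entropy μ (g ∘ φ) := by
  unfold entropy
  rw [integral_map hφ.aemeasurable hg.aestronglyMeasurable,
    integral_map hφ.aemeasurable (by fun_prop)]
  rfl

lemma tendsto_entropy {ι : Type*} {l : Filter ι} [l.IsCountablyGenerated]
    [IsProbabilityMeasure μ] {g : ι → α → ℝ} {g' : α → ℝ} {B : ℝ} (hg : ∀ i, Measurable (g i))
    (hB : ∀ᶠ i in l, ∀ z, g i z ∈ Set.Icc 0 B)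
    (hlim : ∀ z, Tendsto (fun i => g i z) l (𝓝 (g' z))) :
    Tendsto (fun i => entropy μ (g i)) l (𝓝 (entropy μ g')) := by
  have hmean : Tendsto (fun i => ∫ z, g i z ∂μ) l (𝓝 (∫ z, g' z ∂μ)) := by
    refine tendsto_integral_filter_of_dominated_convergence (fun _ => B)
      (.of_forall fun i => (hg i).aestronglyMeasurable) ?_ (integrable_const _) (ae_of_all _ hlim)
    filter_upwards [hB] with i hi
    exact ae_of_all _ fun z => (Real.norm_of_nonneg (hi z).1).trans_le (hi z).2
  refine Tendsto.sub ?_ ((Real.continuous_mul_log.tendsto _).comp hmean)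
  refine tendsto_integral_filter_of_dominated_convergence (fun _ => 1 + B ^ 2)
    (.of_forall fun i => by have := hg i; fun_prop) ?_ (integrable_const _)
    (ae_of_all _ fun z => (Real.continuous_mul_log.tendsto _).comp (hlim z))
  filter_upwards [hB] with i hi
  exact ae_of_all _ fun z => abs_mul_log_le_of_mem_Icc (hi z)

lemma sub_le_mul_log_sub_log {a b : ℝ} (ha : 0 < a) (hb : 0 < b) :
    a - b ≤ a * (Real.log a - Real.log b) := by
  have h := mul_le_mul_of_nonneg_left (Real.log_le_sub_one_of_pos (div_pos hb ha)) ha.le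
  rw [Real.log_div hb.ne' ha.ne', mul_sub_one, mul_div_cancel₀ _ ha.ne'] at h
  linarith

lemma integral_mul_log_le_of_integral_eq {g w : α → ℝ} (hg : ∀ z, 0 < g z) (hw : ∀ z, 0 < w z)
    (hgi : Integrable g μ) (hwi : Integrable w μ) (heq : ∫ z, w z ∂μ = ∫ z, g z ∂μ)
    (hgg : Integrable (fun z => g z * Real.log (g z)) μ)
    (hgw : Integrable (fun z => g z * Real.log (w z)) μ) :
    ∫ z, g z * Real.log (w z) ∂μ ≤ ∫ z, g z * Real.log (g z) ∂μ := by
  have h : ∫ z, (g z - w z) ∂μ ≤ ∫ z, (g z * Real.log (g z) - g z * Real.log (w z)) ∂μ :=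
    integral_mono (hgi.sub hwi) (hgg.sub hgw) fun z =>
      (sub_le_mul_log_sub_log (hg z) (hw z)).trans_eq (mul_sub _ _ _)
  rw [integral_sub hgi hwi, heq, sub_self, integral_sub hgg hgw] at h
  exact sub_nonneg.1 h

end Entropy

/-! ### Subadditivity of the entropy on product spaces -/

section Tensorization

variable {α β : Type*} [MeasurableSpace α] [MeasurableSpace β] {μ : Measure α} {ν : Measure β}

lemma measurable_integral_right [SFinite ν] {g : α × β → ℝ} (hg : Measurable g) :
    Measurable fun x => ∫ y, g (x, y) ∂ν :=
  hg.stronglyMeasurable.integral_prod_right'.measurable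

lemma measurable_entropy_right [SFinite ν] {g : α × β → ℝ} (hg : Measurable g) :
    Measurable fun x => entropy ν fun y => g (x, y) := by
  have hmean := measurable_integral_right (ν := ν) hg
  exact (measurable_integral_right (g := fun p => g p * Real.log (g p)) (by fun_prop)).sub
    (hmean.mul hmean.log)

lemma integral_mul_comp_fst [SFinite μ] [SFinite ν] {g : α × β → ℝ} {φ : α → ℝ}
    (h : Integrable (fun p : α × β => g p * φ p.1) (μ.prod ν)) :
    ∫ p, g p * φ p.1 ∂μ.prod ν = ∫ x, (∫ y, g (x, y) ∂ν) * φ x ∂μ := by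
  rw [integral_prod _ h]
  simp only [integral_mul_const]

lemma integral_mul_comp_snd [SFinite μ] [SFinite ν] {g : α × β → ℝ} {φ : β → ℝ}
    (h : Integrable (fun p : α × β => g p * φ p.2) (μ.prod ν)) :
    ∫ p, g p * φ p.2 ∂μ.prod ν = ∫ y, (∫ x, g (x, y) ∂μ) * φ y ∂ν := by
  rw [integral_prod_symm _ h]
  simp only [integral_mul_const]

variable [IsProbabilityMeasure μ] [IsProbabilityMeasure ν]

lemma integral_entropy_right {g : α × β → ℝ} {B : ℝ} (hg : Measurable g)
    (hB : ∀ p, g p ∈ Set.Icc 0 B) :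
    ∫ x, entropy ν (fun y => g (x, y)) ∂μ = (∫ p, g p * Real.log (g p) ∂μ.prod ν)
      - ∫ x, (∫ y, g (x, y) ∂ν) * Real.log (∫ y, g (x, y) ∂ν) ∂μ := by
  have hi : Integrable (fun p => g p * Real.log (g p)) (μ.prod ν) := integrable_mul_log hg hB
  rw [integral_prod _ hi, ← integral_sub hi.integral_prod_left]
  · rfl
  · exact integrable_mul_log (measurable_integral_right hg)
      fun x => integral_mem_Icc (hg.comp (by fun_prop)) fun y => hB _

lemma integral_entropy_left {g : α × β → ℝ} {B : ℝ} (hg : Measurable g)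
    (hB : ∀ p, g p ∈ Set.Icc 0 B) :
    ∫ y, entropy μ (fun x => g (x, y)) ∂ν = (∫ p, g p * Real.log (g p) ∂μ.prod ν)
      - ∫ y, (∫ x, g (x, y) ∂μ) * Real.log (∫ x, g (x, y) ∂μ) ∂ν := by
  rw [← integral_prod_swap]
  exact integral_entropy_right (g := g ∘ Prod.swap) (by fun_prop) fun p => hB p.swap

lemma integrable_mul_log_of_pos {g w : α → ℝ} {δ B : ℝ} (hδ : 0 < δ) (hg : Measurable g)
    (hw : Measurable w) (hgB : ∀ z, g z ∈ Set.Icc δ B) (hwB : ∀ z, w z ∈ Set.Icc δ B) :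
    Integrable (fun z => g z * Real.log (w z)) μ := by
  refine (Integrable.of_mem_Icc δ B hg.aemeasurable (ae_of_all _ hgB)).mul_bdd
    (c := max |Real.log δ| |Real.log B|) hw.log.aestronglyMeasurable (ae_of_all _ fun z => ?_)
  exact abs_le_max_abs_abs (Real.log_le_log hδ (hwB z).1)
    (Real.log_le_log (hδ.trans_le (hwB z).1) (hwB z).2)

lemma mul_log_mul_div {a b e : ℝ} (ha : 0 < a) (hb : 0 < b) (he : 0 < e) (c : ℝ) :
    c * Real.log (a * b / e) = c * Real.log a + c * Real.log b - c * Real.log e := by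
  rw [Real.log_div (mul_pos ha hb).ne' he.ne', Real.log_mul ha.ne' hb.ne']
  ring

lemma entropy_prod_le_of_pos {g : α × β → ℝ} {δ B : ℝ} (hδ : 0 < δ) (hg : Measurable g)
    (hB : ∀ p, g p ∈ Set.Icc δ B) :
    entropy (μ.prod ν) g ≤ (∫ x, entropy ν (fun y => g (x, y)) ∂μ)
      + ∫ y, entropy μ (fun x => g (x, y)) ∂ν := by
  have hB0 : ∀ p, g p ∈ Set.Icc 0 B := fun p => Set.Icc_subset_Icc_left hδ.le (hB p)
  rw [integral_entropy_right hg hB0, integral_entropy_left hg hB0, entropy]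
  set r : α → ℝ := fun x => ∫ y, g (x, y) ∂ν
  set k : β → ℝ := fun y => ∫ x, g (x, y) ∂μ
  set E : ℝ := ∫ p, g p ∂μ.prod ν
  have hrm : Measurable r := measurable_integral_right hg
  have hkm : Measurable k := measurable_integral_right (g := g ∘ Prod.swap) (by fun_prop)
  have hrB : ∀ x, r x ∈ Set.Icc δ B := fun x => integral_mem_Icc (by fun_prop) fun y => hB _
  have hkB : ∀ y, k y ∈ Set.Icc δ B := fun y => integral_mem_Icc (by fun_prop) fun x => hB _
  have hr : ∀ x, 0 < r x := fun x => hδ.trans_le (hrB x).1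
  have hk : ∀ y, 0 < k y := fun y => hδ.trans_le (hkB y).1
  have hE : 0 < E := hδ.trans_le (integral_mem_Icc hg hB).1
  have hgi : Integrable g (μ.prod ν) := .of_mem_Icc δ B hg.aemeasurable (ae_of_all _ hB)
  have hgr : Integrable (fun p : α × β => g p * Real.log (r p.1)) (μ.prod ν) :=
    integrable_mul_log_of_pos hδ hg (hrm.comp measurable_fst) hB fun p => hrB p.1
  have hgk : Integrable (fun p : α × β => g p * Real.log (k p.2)) (μ.prod ν) :=
    integrable_mul_log_of_pos hδ hg (hkm.comp measurable_snd) hB fun p => hkB p.2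
  have hgrk : Integrable (fun p : α × β => g p * Real.log (r p.1) + g p * Real.log (k p.2))
      (μ.prod ν) := hgr.add hgk
  -- The competitor is the product of the marginals, rescaled to have the same integral as `g`.
  have hgibbs : ∫ p, g p * Real.log (r p.1 * k p.2 / E) ∂μ.prod ν
      ≤ ∫ p, g p * Real.log (g p) ∂μ.prod ν := by
    refine integral_mul_log_le_of_integral_eq (fun p => hδ.trans_le (hB p).1)
      (fun p => div_pos (mul_pos (hr _) (hk _)) hE) hgi
      ((hgi.integral_prod_left.mul_prod hgi.integral_prod_right).div_const E) ?_
      (integrable_mul_log_of_pos hδ hg hg hB hB) ?_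
    · rw [integral_div, integral_prod_mul, ← integral_prod _ hgi, ← integral_prod_symm _ hgi,
        mul_div_cancel_right₀ _ hE.ne']
    · simp only [mul_log_mul_div (hr _) (hk _) hE]
      exact hgrk.sub (hgi.mul_const _)
  simp only [mul_log_mul_div (hr _) (hk _) hE] at hgibbs
  rw [integral_sub hgrk (hgi.mul_const _), integral_add hgr hgk, integral_mul_const,
    integral_mul_comp_fst (φ := fun x => Real.log (r x)) hgr,
    integral_mul_comp_snd (φ := fun y => Real.log (k y)) hgk] at hgibbs
  linarith

lemma tendsto_integral_entropy_right {ι : Type*} {l : Filter ι} [l.IsCountablyGenerated]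
    {g : ι → α × β → ℝ} {g' : α × β → ℝ} {B : ℝ} (hg : ∀ i, Measurable (g i))
    (hB : ∀ᶠ i in l, ∀ p, g i p ∈ Set.Icc 0 B)
    (hlim : ∀ p, Tendsto (fun i => g i p) l (𝓝 (g' p))) :
    Tendsto (fun i => ∫ x, entropy ν (fun y => g i (x, y)) ∂μ) l
      (𝓝 (∫ x, entropy ν (fun y => g' (x, y)) ∂μ)) := by
  have hslice : ∀ i x, Measurable fun y => g i (x, y) := fun i x => (hg i).comp (by fun_prop)
  refine tendsto_integral_filter_of_dominated_convergence (fun _ => 2 * (1 + B ^ 2))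
    (.of_forall fun i => (measurable_entropy_right (hg i)).aestronglyMeasurable) ?_
    (integrable_const _) (ae_of_all _ fun x => tendsto_entropy (fun i => hslice i x)
      (hB.mono fun i hi y => hi _) fun y => hlim _)
  filter_upwards [hB] with i hi
  exact ae_of_all _ fun x => abs_entropy_le (hslice i x) fun y => hi _

theorem entropy_prod_le {g : α × β → ℝ} {B : ℝ} (hg : Measurable g)
    (hB : ∀ p, g p ∈ Set.Icc 0 B) :
    entropy (μ.prod ν) g ≤ (∫ x, entropy ν (fun y => g (x, y)) ∂μ)
      + ∫ y, entropy μ (fun x => g (x, y)) ∂ν := by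
  have hgm : ∀ ε : ℝ, Measurable fun p => g p + ε := fun ε => hg.add_const ε
  have hlim : ∀ p, Tendsto (fun ε => g p + ε) (𝓝[>] 0) (𝓝 (g p)) := fun p =>
    tendsto_nhdsWithin_of_tendsto_nhds <| by
      simpa using (continuous_const.add continuous_id).tendsto (f := fun ε : ℝ => g p + ε) 0
  have hε : ∀ᶠ ε : ℝ in 𝓝[>] 0, ε ∈ Set.Ioo 0 1 := Ioo_mem_nhdsGT one_pos
  have hmem : ∀ ε ∈ Set.Ioo (0 : ℝ) 1, ∀ p, g p + ε ∈ Set.Icc ε (B + 1) := fun ε hε p =>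
    ⟨by linarith [(hB p).1], by linarith [(hB p).2, hε.2]⟩
  have hmem₀ : ∀ᶠ ε : ℝ in 𝓝[>] 0, ∀ p, g p + ε ∈ Set.Icc 0 (B + 1) :=
    hε.mono fun ε hε p => Set.Icc_subset_Icc_left hε.1.le (hmem ε hε p)
  refine le_of_tendsto_of_tendsto (tendsto_entropy hgm hmem₀ hlim)
    ((tendsto_integral_entropy_right hgm hmem₀ hlim).add
      (tendsto_integral_entropy_right (g := fun ε p => g p.swap + ε) (g' := g ∘ Prod.swap)
        (fun ε => (hgm ε).comp measurable_swap) (hmem₀.mono fun ε h p => h _) fun p => hlim _))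
    (hε.mono fun ε hε => entropy_prod_le_of_pos hε.1 (hgm ε) (hmem ε hε))

lemma entropy_conv_le {F : Type*} [AddMonoid F] [MeasurableSpace F] [MeasurableAdd₂ F]
    {μ ν : Measure F} [IsProbabilityMeasure μ] [IsProbabilityMeasure ν] {g : F → ℝ} {B : ℝ}
    (hg : Measurable g) (hB : ∀ z, g z ∈ Set.Icc 0 B) :
    entropy (μ ∗ ν) g ≤ (∫ x, entropy ν (fun y => g (x + y)) ∂μ)
      + ∫ y, entropy μ (fun x => g (x + y)) ∂ν := by
  rw [Measure.conv, entropy_map measurable_add hg]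
  exact entropy_prod_le (hg.comp measurable_add) fun p => hB _

end Tensorization

/-! ### The log-Sobolev inequality for the standard Gaussian law on the line -/

lemma exp_neg_le_quadratic {p : ℝ} (hp : 0 ≤ p) : Real.exp (-p) ≤ 1 - p + p ^ 2 / 2 := by
  rw [Real.exp_neg, inv_le_iff_one_le_mul₀ (Real.exp_pos p)]
  calc (1 : ℝ) ≤ (1 - p + p ^ 2 / 2) * (1 + p + p ^ 2 / 2) := by nlinarith [sq_nonneg (p ^ 2)]
    _ ≤ (1 - p + p ^ 2 / 2) * Real.exp p :=
      mul_le_mul_of_nonneg_left (Real.quadratic_le_exp_of_nonneg hp) (by nlinarith)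

lemma mul_log_sq_sub_log_le {a b : ℝ} (hb : 0 ≤ b) (hab : b < a) :
    a * (Real.log (a ^ 2) - Real.log ((a ^ 2 + b ^ 2) / 2)) ≤ a - b := by
  have ha : 0 < a := hb.trans_lt hab
  have hratio : Real.exp (-((a - b) / a)) ≤ (a ^ 2 + b ^ 2) / 2 / a ^ 2 :=
    (exp_neg_le_quadratic (div_nonneg (sub_nonneg.2 hab.le) ha.le)).trans_eq (by field_simp; ring)
  have hlog := Real.log_le_log (Real.exp_pos _) hratio
  rw [Real.log_exp, Real.log_div (by positivity) (by positivity), neg_le, neg_sub,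
    le_div_iff₀ ha, mul_comm] at hlog
  exact hlog

lemma two_point_entropy_le_of_le {a b : ℝ} (hb : 0 ≤ b) (hab : b ≤ a) :
    (a ^ 2 * Real.log (a ^ 2) + b ^ 2 * Real.log (b ^ 2)) / 2
      - (a ^ 2 + b ^ 2) / 2 * Real.log ((a ^ 2 + b ^ 2) / 2) ≤ (a - b) ^ 2 / 2 := by
  let D : ℝ → ℝ := fun x => (x - b) ^ 2 / 2
    - ((x ^ 2 * Real.log (x ^ 2) + b ^ 2 * Real.log (b ^ 2)) / 2
      - (x ^ 2 + b ^ 2) / 2 * Real.log ((x ^ 2 + b ^ 2) / 2))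
  have hD : Continuous D := by
    have hmean : Continuous fun x : ℝ => (x ^ 2 + b ^ 2) / 2 := by fun_prop
    exact (by fun_prop : Continuous fun x : ℝ => (x - b) ^ 2 / 2).sub
      ((((Real.continuous_mul_log.comp (continuous_pow 2)).add continuous_const).div_const 2).sub
        (Real.continuous_mul_log.comp hmean))
  have hderiv : ∀ x ∈ interior (Set.Ici b), HasDerivAt D
      (x - b - x * (Real.log (x ^ 2) - Real.log ((x ^ 2 + b ^ 2) / 2))) x := by
    intro x hx
    rw [interior_Ici] at hx
    have hx0 : 0 < x := hb.trans_lt hx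
    have hsq : HasDerivAt (fun x : ℝ => x ^ 2) (2 * x) x := by simpa using hasDerivAt_pow 2 x
    have hmean := (hsq.add_const (b ^ 2)).div_const 2
    have hdiff := (((hasDerivAt_id x).sub_const b).pow 2).div_const 2
    have hxx := HasDerivAt.comp (h := fun x : ℝ => x ^ 2) x
      (Real.hasDerivAt_mul_log (by positivity)) hsq
    have hmm := HasDerivAt.comp (h := fun x : ℝ => (x ^ 2 + b ^ 2) / 2) x
      (Real.hasDerivAt_mul_log (by positivity)) hmean
    convert! hdiff.sub (((hxx.add_const (b ^ 2 * Real.log (b ^ 2))).div_const 2).sub hmm) using 1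
    simp only [id]
    push_cast
    ring
  have hmono : MonotoneOn D (Set.Ici b) :=
    monotoneOn_of_hasDerivWithinAt_nonneg (convex_Ici b) hD.continuousOn
      (fun x hx => (hderiv x hx).hasDerivWithinAt) fun x hx =>
        sub_nonneg.2 (mul_log_sq_sub_log_le hb (by simpa using hx))
  have hDb : D b = 0 := by simp only [D]; ring_nf
  exact sub_nonneg.1 (hDb.symm.le.trans (hmono Set.self_mem_Ici hab hab))

lemma two_point_entropy_le (a b : ℝ) :
    (a ^ 2 * Real.log (a ^ 2) + b ^ 2 * Real.log (b ^ 2)) / 2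
      - (a ^ 2 + b ^ 2) / 2 * Real.log ((a ^ 2 + b ^ 2) / 2) ≤ (a - b) ^ 2 / 2 := by
  have habs : (|a| - |b|) ^ 2 ≤ (a - b) ^ 2 := sq_le_sq.2 (abs_abs_sub_abs_le a b)
  rw [← sq_abs a, ← sq_abs b]
  rcases le_total |b| |a| with h | h
  · linarith [two_point_entropy_le_of_le (abs_nonneg b) h]
  · have := two_point_entropy_le_of_le (abs_nonneg a) h
    rw [add_comm (|b| ^ 2), add_comm (|b| ^ 2 * _)] at this
    nlinarith

/-- The uniform law on `{h, -h}`. -/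
noncomputable def signMeasure (h : ℝ) : Measure ℝ :=
  (2⁻¹ : ℝ≥0∞) • Measure.dirac h + (2⁻¹ : ℝ≥0∞) • Measure.dirac (-h)

instance (h : ℝ) : IsProbabilityMeasure (signMeasure h) :=
  ⟨by simp [signMeasure, ENNReal.inv_two_add_inv_two]⟩

lemma integral_signMeasure {G : Type*} [NormedAddCommGroup G] [NormedSpace ℝ G] [CompleteSpace G]
    (h : ℝ) (φ : ℝ → G) : ∫ y, φ y ∂signMeasure h = (2⁻¹ : ℝ) • (φ h + φ (-h)) := by
  have hi : ∀ x, Integrable φ ((2⁻¹ : ℝ≥0∞) • Measure.dirac x) := fun x =>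
    (integrable_dirac (by simp)).smul_measure (by simp)
  rw [signMeasure, integral_add_measure (hi _) (hi _)]
  simp [integral_smul_measure]

/-- The law of the sum of `n` independent uniform signs, scaled by `h`. -/
noncomputable def signWalk (h : ℝ) : ℕ → Measure ℝ
  | 0 => Measure.dirac 0
  | n + 1 => signWalk h n ∗ signMeasure h

instance isProbabilityMeasure_signWalk (h : ℝ) : ∀ n, IsProbabilityMeasure (signWalk h n)
  | 0 => by unfold signWalk; infer_instance
  | n + 1 => by
    have := isProbabilityMeasure_signWalk h n
    unfold signWalk; infer_instance

section SignWalk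

variable {B : ℝ}

lemma sq_mem_Icc {a : ℝ} (ha : |a| ≤ B) : a ^ 2 ∈ Set.Icc 0 (B ^ 2) :=
  ⟨sq_nonneg a, sq_le_sq' (abs_le.1 ha).1 (abs_le.1 ha).2⟩

lemma entropy_signMeasure_sq_le (h : ℝ) (T : ℝ → ℝ) :
    entropy (signMeasure h) (fun y => T y ^ 2) ≤ (T h - T (-h)) ^ 2 / 2 := by
  simp only [entropy, integral_signMeasure, smul_eq_mul]
  convert! two_point_entropy_le (T h) (T (-h)) using 2 <;> ring_nf

lemma integral_signWalk_succ {h : ℝ} {φ : ℝ → ℝ} {C : ℝ} (hφ : Measurable φ)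
    (hC : ∀ x, φ x ∈ Set.Icc 0 C) (n : ℕ) :
    ∫ x, φ x ∂signWalk h (n + 1)
      = ((∫ x, φ (x + h) ∂signWalk h n) + ∫ x, φ (x - h) ∂signWalk h n) / 2 := by
  have hi : ∀ (μ : Measure ℝ) [IsProbabilityMeasure μ] (c : ℝ),
      Integrable (fun x => φ (x + c)) μ := fun μ _ c =>
    .of_mem_Icc 0 C (by fun_prop) (ae_of_all _ fun x => hC _)
  rw [signWalk, integral_conv (by simpa using hi _ 0)]
  simp only [integral_signMeasure, smul_eq_mul, integral_const_mul, sub_eq_add_neg]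
  rw [integral_add (hi _ _) (hi _ _)]
  ring

lemma entropy_signWalk_sq_le (h : ℝ) (n : ℕ) : ∀ {T : ℝ → ℝ}, Measurable T → (∀ x, |T x| ≤ B) →
    entropy (signWalk h (n + 1)) (fun y => T y ^ 2)
      ≤ (n + 1) / 2 * ∫ x, (T (x + h) - T (x - h)) ^ 2 ∂signWalk h n := by
  induction n with
  | zero =>
    intro T _ _
    simp only [signWalk, Measure.dirac_zero_conv, integral_dirac, zero_add, zero_sub]
    refine (entropy_signMeasure_sq_le h T).trans_eq ?_
    push_cast
    ring
  | succ n ih =>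
    intro T hT hTB
    have hsq : ∀ x, T x ^ 2 ∈ Set.Icc 0 (B ^ 2) := fun x => sq_mem_Icc (hTB x)
    let D : ℝ → ℝ := fun x => (T (x + h) - T (x - h)) ^ 2
    have hDm : Measurable D := by fun_prop
    have hD : ∀ x, D x ∈ Set.Icc 0 ((2 * B) ^ 2) := fun x =>
      sq_mem_Icc ((abs_sub _ _).trans (by linarith [hTB (x + h), hTB (x - h)]))
    have hlast : ∫ x, entropy (signMeasure h) (fun y => T (x + y) ^ 2) ∂signWalk h (n + 1)
        ≤ (∫ x, D x ∂signWalk h (n + 1)) / 2 := by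
      rw [← integral_div]
      refine integral_mono (.of_mem_Icc 0 (2 * (1 + (B ^ 2) ^ 2)) ?_ (ae_of_all _ fun x => ?_))
        ((Integrable.of_mem_Icc 0 _ hDm.aemeasurable (ae_of_all _ hD)).div_const 2) fun x => ?_
      · exact (measurable_entropy_right (g := fun p : ℝ × ℝ => T (p.1 + p.2) ^ 2)
          (by fun_prop)).aemeasurable
      · exact ⟨entropy_nonneg (by fun_prop) fun y => hsq _,
          (le_abs_self _).trans (abs_entropy_le (by fun_prop) fun y => hsq _)⟩
      · simpa only [D, sub_eq_add_neg] using entropy_signMeasure_sq_le h fun y => T (x + y)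
    have hfirst : ∫ y, entropy (signWalk h (n + 1)) (fun x => T (x + y) ^ 2) ∂signMeasure h
        ≤ (n + 1) / 2 * ∫ x, D x ∂signWalk h (n + 1) := by
      have hshift : ∀ c, entropy (signWalk h (n + 1)) (fun x => T (x + c) ^ 2)
          ≤ (n + 1) / 2 * ∫ x, D (x + c) ∂signWalk h n := fun c => by
        simpa only [D, add_right_comm _ h c, sub_add_eq_add_sub] using
          ih (T := fun x => T (x + c)) (by fun_prop) fun x => hTB _
      rw [integral_signMeasure, integral_signWalk_succ hDm hD]
      have hminus := hshift (-h)
      simp only [← sub_eq_add_neg, smul_eq_mul] at hminus ⊢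
      linarith [hshift h]
    calc entropy (signWalk h (n + 1) ∗ signMeasure h) (fun y => T y ^ 2)
        ≤ _ := entropy_conv_le (by fun_prop) hsq
      _ ≤ _ := add_le_add hlast hfirst
      _ = ((n + 1 : ℕ) + 1) / 2 * ∫ x, D x ∂signWalk h (n + 1) := by push_cast; ring

lemma charFun_signWalk (h : ℝ) (n : ℕ) (t : ℝ) :
    charFun (signWalk h n) t = charFun (signMeasure 1) (h * t) ^ n := by
  induction n with
  | zero => simp [signWalk]
  | succ n ih =>
    rw [signWalk, charFun_conv, ih, pow_succ]
    congr 1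
    simp only [charFun_apply_real, integral_signMeasure]
    push_cast
    ring_nf

lemma tendsto_integral_signWalk {φ : ℝ → ℝ} {C : ℝ} (hφ : Continuous φ) (hC : ∀ x, |φ x| ≤ C) :
    Tendsto (fun n : ℕ => ∫ x, φ x ∂signWalk (√n)⁻¹ n) atTop
      (𝓝 (∫ x, φ x ∂gaussianReal 0 1)) := by
  have hweak := (ProbabilityMeasure.tendsto_iff_tendsto_charFun
    (μ := fun n : ℕ => (⟨signWalk (√n)⁻¹ n, inferInstance⟩ : ProbabilityMeasure ℝ))
    (μ₀ := ⟨gaussianReal 0 1, inferInstance⟩)).2 fun t => ?_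
  · exact ProbabilityMeasure.tendsto_iff_forall_integral_tendsto.1 hweak
      (.ofNormedAddCommGroup φ hφ C hC)
  · have hclt := tendsto_charFun_inv_sqrt_mul_pow (P := signMeasure 1) (X := id) aemeasurable_id
      (by simp [integral_signMeasure]) (by norm_num [integral_signMeasure]) t
    rw [Measure.map_id] at hclt
    simpa [charFun_signWalk, charFun_gaussianReal, neg_div] using hclt

lemma tendsto_entropy_signWalk {φ : ℝ → ℝ} {C : ℝ} (hφ : Continuous φ)
    (hC : ∀ x, φ x ∈ Set.Icc 0 C) :
    Tendsto (fun n : ℕ => entropy (signWalk (√n)⁻¹ n) φ) atTop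
      (𝓝 (entropy (gaussianReal 0 1) φ)) :=
  (tendsto_integral_signWalk (Real.continuous_mul_log.comp hφ)
    fun x => abs_mul_log_le_of_mem_Icc (hC x)).sub
  ((Real.continuous_mul_log.tendsto _).comp <| tendsto_integral_signWalk hφ fun x => by
    rw [abs_of_nonneg (hC x).1]; exact (hC x).2)

end SignWalk

section SymmQuot

/-- The symmetric difference quotient of `A` at `x`, with step `ε` on either side. -/
noncomputable def symmQuot (A : ℝ → ℝ) (ε x : ℝ) : ℝ := (A (x + ε) - A (x - ε)) / (2 * ε)

variable {A A' : ℝ → ℝ} {B : ℝ}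

lemma tendsto_symmQuot {a x : ℝ} (hA : HasDerivAt A a x) :
    Tendsto (fun ε => symmQuot A ε x) (𝓝[>] 0) (𝓝 a) := by
  have hslope := hasDerivAt_iff_tendsto_slope_zero.1 hA
  have hpos : Tendsto (fun ε : ℝ => ε) (𝓝[>] 0) (𝓝[≠] 0) :=
    tendsto_id.mono_left (nhdsWithin_mono 0 fun ε (hε : 0 < ε) => hε.ne')
  have hneg : Tendsto (fun ε : ℝ => -ε) (𝓝[>] 0) (𝓝[≠] 0) :=
    tendsto_nhdsWithin_iff.2 ⟨by simpa using (tendsto_nhdsWithin_iff.1 hpos).1.neg,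
      eventually_mem_nhdsWithin.mono fun ε (hε : 0 < ε) => neg_ne_zero.2 hε.ne'⟩
  have hmean := ((hslope.comp hpos).add (hslope.comp hneg)).div_const 2
  rw [add_self_div_two] at hmean
  refine hmean.congr' (eventually_mem_nhdsWithin.mono fun ε (hε : 0 < ε) => ?_)
  simp only [Function.comp, symmQuot, smul_eq_mul, ← sub_eq_add_neg]
  field_simp
  ring

lemma exists_symmQuot_eq (hA : ∀ x, HasDerivAt A (A' x) x) {ε : ℝ} (hε : 0 < ε) (x : ℝ) :
    ∃ ξ, |ξ - x| < ε ∧ symmQuot A ε x = A' ξ := by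
  obtain ⟨ξ, hξ, h⟩ := exists_hasDerivAt_eq_slope A A' (by linarith : x - ε < x + ε)
    (fun y _ => (hA y).continuousAt.continuousWithinAt) fun y _ => hA y
  refine ⟨ξ, abs_sub_lt_iff.2 ⟨by linarith [hξ.2], by linarith [hξ.1]⟩, ?_⟩
  rw [h, symmQuot]
  ring

lemma abs_symmQuot_le (hA : ∀ x, HasDerivAt A (A' x) x) (hB : ∀ x, |A' x| ≤ B) {ε : ℝ}
    (hε : 0 < ε) (x : ℝ) : |symmQuot A ε x| ≤ B := by
  obtain ⟨ξ, -, h⟩ := exists_symmQuot_eq hA hε x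
  exact h ▸ hB ξ

lemma hasDerivAt_symmQuot (hA : ∀ x, HasDerivAt A (A' x) x) (ε x : ℝ) :
    HasDerivAt (symmQuot A ε) (symmQuot A' ε x) x :=
  (((hA _).comp_add_const x ε).sub ((hA _).comp_sub_const x ε)).div_const _

lemma lipschitzWith_symmQuot {K : NNReal} (hA : LipschitzWith K A) {ε : ℝ} (hε : 0 < ε) :
    LipschitzWith (K / ε.toNNReal) (symmQuot A ε) := by
  refine LipschitzWith.of_dist_le_mul fun x y => ?_
  have hplus := hA.dist_le_mul (x + ε) (y + ε)
  have hminus := hA.dist_le_mul (x - ε) (y - ε)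
  rw [dist_add_right] at hplus
  rw [dist_sub_right] at hminus
  simp only [Real.dist_eq] at *
  rw [symmQuot, symmQuot, ← sub_div, abs_div, abs_of_pos (by linarith : 0 < 2 * ε),
    div_le_iff₀ (by linarith)]
  calc |A (x + ε) - A (x - ε) - (A (y + ε) - A (y - ε))|
      = |(A (x + ε) - A (y + ε)) - (A (x - ε) - A (y - ε))| := by ring_nf
    _ ≤ K * |x - y| + K * |x - y| := (abs_sub _ _).trans (add_le_add hplus hminus)
    _ = ↑(K / ε.toNNReal) * |x - y| * (2 * ε) := by
      rw [NNReal.coe_div, Real.coe_toNNReal ε hε.le]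
      field_simp
      ring

end SymmQuot

section Gaussian

variable {T T' : ℝ → ℝ} {B : ℝ}

lemma integral_symmQuot_sq_signWalk_le (hT : ∀ x, HasDerivAt T (T' x) x) (hTB' : ∀ x, |T' x| ≤ B)
    {K : NNReal} (hlip : LipschitzWith K T') {h : ℝ} (hh : 0 < h) (n : ℕ) :
    ∫ x, symmQuot T h x ^ 2 ∂signWalk h n
      ≤ (∫ x, T' x ^ 2 ∂signWalk h (n + 1)) + 4 * B * K * h := by
  have hTm : Measurable T :=
    (continuous_iff_continuousAt.2 fun x => (hT x).continuousAt).measurable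
  have hTm' : Measurable T' := hlip.continuous.measurable
  have hsq : ∀ x, T' x ^ 2 ∈ Set.Icc 0 (B ^ 2) := fun x => sq_mem_Icc (hTB' x)
  have hosc : ∀ ξ y, |ξ - y| ≤ 2 * h → T' ξ ^ 2 ≤ T' y ^ 2 + 4 * B * K * h := fun ξ y hy => by
    have : 0 ≤ B := (abs_nonneg _).trans (hTB' ξ)
    have hdiff : |T' ξ - T' y| ≤ K * (2 * h) :=
      (hlip.dist_le_mul ξ y).trans (mul_le_mul_of_nonneg_left hy K.2)
    have hsum : |T' ξ + T' y| ≤ 2 * B := (abs_add_le _ _).trans (by linarith [hTB' ξ, hTB' y])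
    have hprod : (T' ξ - T' y) * (T' ξ + T' y) ≤ K * (2 * h) * (2 * B) :=
      (le_abs_self _).trans <| (abs_mul _ _).trans_le <|
        mul_le_mul hdiff hsum (abs_nonneg _) (by positivity)
    linarith
  have hquot : ∀ x, symmQuot T h x ^ 2
      ≤ (T' (x + h) ^ 2 + T' (x - h) ^ 2) / 2 + 4 * B * K * h := fun x => by
    obtain ⟨ξ, hξ, hξe⟩ := exists_symmQuot_eq hT hh x
    rw [abs_lt] at hξ
    have hright := hosc ξ (x + h) (abs_le.2 ⟨by linarith, by linarith⟩)
    have hleft := hosc ξ (x - h) (abs_le.2 ⟨by linarith, by linarith⟩)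
    rw [hξe]
    linarith
  have hi : ∀ c, Integrable (fun x => T' (x + c) ^ 2) (signWalk h n) := fun c =>
    .of_mem_Icc 0 (B ^ 2) (by fun_prop) (ae_of_all _ fun x => hsq _)
  have hsum : Integrable (fun x => (T' (x + h) ^ 2 + T' (x - h) ^ 2) / 2) (signWalk h n) :=
    ((hi h).add (by simpa only [sub_eq_add_neg] using hi (-h))).div_const 2
  have hbound : Integrable
      (fun x => (T' (x + h) ^ 2 + T' (x - h) ^ 2) / 2 + 4 * B * K * h) (signWalk h n) :=
    hsum.add (integrable_const _)
  refine (integral_mono (.of_mem_Icc 0 (B ^ 2) ?_ (ae_of_all _ fun x => ?_)) hbound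
    hquot).trans_eq ?_
  · simp only [symmQuot]; fun_prop
  · exact sq_mem_Icc (abs_symmQuot_le hT hTB' hh x)
  · rw [integral_signWalk_succ (hTm'.pow_const 2) hsq, integral_add hsum (integrable_const _),
      integral_div, integral_add (hi h) (by simpa only [sub_eq_add_neg] using hi (-h))]
    simp

lemma entropy_gaussianReal_sq_le_of_lipschitz (hT : ∀ x, HasDerivAt T (T' x) x)
    (hTB : ∀ x, |T x| ≤ B) (hTB' : ∀ x, |T' x| ≤ B) {K : NNReal} (hlip : LipschitzWith K T') :
    entropy (gaussianReal 0 1) (fun y => T y ^ 2) ≤ 2 * ∫ y, T' y ^ 2 ∂gaussianReal 0 1 := by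
  have hTc : Continuous T := continuous_iff_continuousAt.2 fun x => (hT x).continuousAt
  have hent := tendsto_entropy_signWalk (hTc.pow 2) fun x => sq_mem_Icc (hTB x)
  have hgrad := tendsto_integral_signWalk (hlip.continuous.pow 2) fun x =>
    (abs_of_nonneg (sq_nonneg (T' x))).trans_le (sq_mem_Icc (hTB' x)).2
  have hstep : Tendsto (fun n : ℕ => (√n)⁻¹) atTop (𝓝 0) :=
    tendsto_inv_atTop_zero.comp (Real.tendsto_sqrt_atTop.comp tendsto_natCast_atTop_atTop)
  have hrhs := (hgrad.add (hstep.const_mul (4 * B * K))).const_mul 2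
  rw [mul_zero, add_zero] at hrhs
  refine le_of_tendsto_of_tendsto' (hent.comp (tendsto_add_atTop_nat 1))
    (hrhs.comp (tendsto_add_atTop_nat 1)) fun n => ?_
  set h : ℝ := (√(n + 1 : ℕ))⁻¹ with hh
  have hpos : 0 < h := by positivity
  have hnh : (n + 1) * h ^ 2 = 1 := by
    rw [hh, inv_pow, Real.sq_sqrt (by positivity), Nat.cast_succ]
    exact mul_inv_cancel₀ (by positivity)
  calc entropy (signWalk h (n + 1)) (fun y => T y ^ 2)
      ≤ (n + 1) / 2 * ∫ x, (T (x + h) - T (x - h)) ^ 2 ∂signWalk h n :=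
        entropy_signWalk_sq_le h n hTc.measurable hTB
    _ = (n + 1) / 2 * ∫ x, (2 * h) ^ 2 * symmQuot T h x ^ 2 ∂signWalk h n := by
        congr 2 with x
        rw [symmQuot]
        field_simp
    _ = 2 * ∫ x, symmQuot T h x ^ 2 ∂signWalk h n := by
        rw [integral_const_mul]
        linear_combination (2 * ∫ x, symmQuot T h x ^ 2 ∂signWalk h n) * hnh
    _ ≤ _ := mul_le_mul_of_nonneg_left
        (integral_symmQuot_sq_signWalk_le hT hTB' hlip hpos n) zero_le_two

-- The difference quotients of a primitive of `T` have Lipschitz derivatives and converge to `T`.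
theorem entropy_gaussianReal_sq_le (hT : ∀ x, HasDerivAt T (T' x) x)
    (hTB : ∀ x, |T x| ≤ B) (hTB' : ∀ x, |T' x| ≤ B) :
    entropy (gaussianReal 0 1) (fun y => T y ^ 2) ≤ 2 * ∫ y, T' y ^ 2 ∂gaussianReal 0 1 := by
  have hTc : Continuous T := continuous_iff_continuousAt.2 fun x => (hT x).continuousAt
  have hlip : LipschitzWith B.toNNReal T :=
    lipschitzWith_of_nnnorm_deriv_le (fun x => (hT x).differentiableAt) fun x => by
      rw [← NNReal.coe_le_coe, coe_nnnorm, (hT x).deriv,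
        Real.coe_toNNReal _ ((abs_nonneg _).trans (hTB' x))]
      exact hTB' x
  let A : ℝ → ℝ := fun x => ∫ s in (0 : ℝ)..x, T s
  have hA : ∀ x, HasDerivAt A (T x) x := fun x =>
    intervalIntegral.integral_hasDerivAt_right (hTc.intervalIntegrable _ _)
      hTc.stronglyMeasurable.stronglyMeasurableAtFilter hTc.continuousAt
  have hAm : Measurable A :=
    (continuous_iff_continuousAt.2 fun x => (hA x).continuousAt).measurable
  have := hTc.measurable
  refine le_of_tendsto_of_tendsto (b := 𝓝[>] 0)
    (f := fun ε => entropy (gaussianReal 0 1) (fun y => symmQuot A ε y ^ 2))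
    (g := fun ε => 2 * ∫ y, symmQuot T ε y ^ 2 ∂gaussianReal 0 1) ?_ ?_ ?_
  · refine tendsto_entropy (fun ε => by simp only [symmQuot]; fun_prop)
      (eventually_mem_nhdsWithin.mono fun ε hε y => sq_mem_Icc (abs_symmQuot_le hA hTB hε y))
      fun y => (tendsto_symmQuot (hA y)).pow 2
  · refine (tendsto_integral_filter_of_dominated_convergence (fun _ => B ^ 2)
      (.of_forall fun ε => by simp only [symmQuot]; fun_prop)
      (eventually_mem_nhdsWithin.mono fun ε hε => ae_of_all _ fun y => ?_) (integrable_const _)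
      (ae_of_all _ fun y => (tendsto_symmQuot (hT y)).pow 2)).const_mul 2
    exact (Real.norm_of_nonneg (sq_nonneg _)).trans_le
      (sq_mem_Icc (abs_symmQuot_le hT hTB' hε y)).2
  · exact eventually_mem_nhdsWithin.mono fun ε hε =>
      entropy_gaussianReal_sq_le_of_lipschitz (hasDerivAt_symmQuot hA ε)
        (abs_symmQuot_le hA hTB hε) (abs_symmQuot_le hT hTB' hε) (lipschitzWith_symmQuot hlip hε)

end Gaussian

/-! ### Log-Sobolev inequalities under convolution -/

section FormLSI

variable {F : Type*} [NormedAddCommGroup F] [InnerProductSpace ℝ F] [CompleteSpace F]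

lemma continuous_gradient_of_contDiff {f : F → ℝ} (hf : ContDiff ℝ 1 f) :
    Continuous (gradient f) :=
  (InnerProductSpace.toDual ℝ F).symm.continuous.comp (hf.continuous_fderiv (by simp))

lemma gradient_comp_add_const (f : F → ℝ) (y x : F) :
    gradient (fun z => f (z + y)) x = gradient f (x + y) := by
  simp only [gradient, fderiv_comp_add_right]

lemma hasDerivAt_comp_add_smul {f : F → ℝ} {g x e : F} {t : ℝ}
    (hf : HasGradientAt f g (x + t • e)) :
    HasDerivAt (fun t : ℝ => f (x + t • e)) (inner ℝ g e) t := by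
  have hline : HasDerivAt (fun t : ℝ => x + t • e) e t := by
    simpa using ((hasDerivAt_id t).smul_const e).const_add x
  exact hf.hasFDerivAt.comp_hasDerivAt t hline

variable [MeasurableSpace F]

/-- The log-Sobolev inequality `Ent_μ(f²) ≤ 2 ∫ Q(∇f) dμ` with an arbitrary energy form `Q`. For
`Q = C |·|²` it is `SatisfiesLSI μ C`; keeping the form of an anisotropic Gaussian law makes the
energies of independent summands additive without loss. -/
def FormLSI (μ : Measure F) (Q : F → ℝ) : Prop :=
  ∀ f : F → ℝ, ContDiff ℝ 1 f → (∃ B : ℝ, ∀ z, |f z| ≤ B) → (∃ B : ℝ, ∀ z, ‖gradient f z‖ ≤ B) →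
    entropy μ (fun z => f z ^ 2) ≤ 2 * ∫ z, Q (gradient f z) ∂μ

lemma formLSI_iff_satisfiesLSI {μ : Measure F} {C : ℝ} :
    FormLSI μ (fun ξ => C * ‖ξ‖ ^ 2) ↔ SatisfiesLSI μ C := by
  simp only [FormLSI, SatisfiesLSI, integral_const_mul, mul_assoc]

lemma formLSI_dirac [MeasurableSingletonClass F] (a : F) :
    FormLSI (Measure.dirac a) fun _ => 0 := by
  intro f _ _ _
  simp [entropy]

variable [BorelSpace F]

lemma formLSI_gaussianReal_smul (e : F) :
    FormLSI ((gaussianReal 0 1).map fun t : ℝ => t • e) fun ξ => inner ℝ ξ e ^ 2 := by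
  rintro f hf ⟨A, hA⟩ ⟨B, hB⟩
  have hem : Measurable fun t : ℝ => t • e := by fun_prop
  have hgrad : Continuous fun z => inner ℝ (gradient f z) e ^ 2 :=
    ((continuous_gradient_of_contDiff hf).inner continuous_const).pow 2
  have hderiv : ∀ t : ℝ, HasDerivAt (fun t : ℝ => f (t • e)) (inner ℝ (gradient f (t • e)) e) t :=
    fun t => by simpa only [zero_add] using
      hasDerivAt_comp_add_smul (x := 0) (hf.differentiable one_ne_zero _).hasGradientAt
  rw [entropy_map hem (hf.continuous.measurable.pow_const 2),
    integral_map hem.aemeasurable hgrad.aestronglyMeasurable]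
  exact entropy_gaussianReal_sq_le hderiv (B := max A (B * ‖e‖))
    (fun t => (hA _).trans (le_max_left _ _))
    (fun t => ((abs_real_inner_le_norm _ _).trans
      (mul_le_mul_of_nonneg_right (hB _) (norm_nonneg _))).trans (le_max_right _ _))

variable [FiniteDimensional ℝ F] {μ ν : Measure F} [IsProbabilityMeasure μ]
  [IsProbabilityMeasure ν] {Q Q' : F → ℝ}

lemma integrable_comp_gradient (hQ : Continuous Q) {f : F → ℝ} (hf : ContDiff ℝ 1 f)
    (hb : ∃ B, ∀ z, ‖gradient f z‖ ≤ B) : Integrable (fun z => Q (gradient f z)) μ := by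
  have := FiniteDimensional.proper_real F
  obtain ⟨B, hB⟩ := hb
  obtain ⟨D, hD⟩ := (isCompact_closedBall (0 : F) B).exists_bound_of_continuousOn hQ.continuousOn
  exact .of_bound (hQ.comp (continuous_gradient_of_contDiff hf)).aestronglyMeasurable D
    (ae_of_all _ fun z => hD _ (mem_closedBall_zero_iff.2 (hB z)))

lemma FormLSI.mono (h : FormLSI μ Q) (hQ : Continuous Q) (hQ' : Continuous Q')
    (hle : ∀ ξ, Q ξ ≤ Q' ξ) : FormLSI μ Q' := fun f hf hb hb' =>
  (h f hf hb hb').trans <| mul_le_mul_of_nonneg_left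
    (integral_mono (integrable_comp_gradient hQ hf hb') (integrable_comp_gradient hQ' hf hb')
      fun _ => hle _) zero_le_two

lemma FormLSI.integral_entropy_translate_le (h : FormLSI ν Q) (hQ : Continuous Q) {f : F → ℝ}
    (hf : ContDiff ℝ 1 f) (hb : ∃ B, ∀ z, |f z| ≤ B) (hb' : ∃ B, ∀ z, ‖gradient f z‖ ≤ B) :
    ∫ x, entropy ν (fun y => f (x + y) ^ 2) ∂μ ≤ 2 * ∫ z, Q (gradient f z) ∂(μ ∗ ν) := by
  have := FiniteDimensional.proper_real F
  obtain ⟨A, hA⟩ := hb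
  obtain ⟨B, hB⟩ := hb'
  have hfm := hf.continuous.measurable
  have hint := integrable_comp_gradient (μ := μ ∗ ν) hQ hf ⟨B, hB⟩
  have hmeas : Measurable fun p : F × F => f (p.1 + p.2) ^ 2 := by fun_prop
  rw [integral_conv hint, ← integral_const_mul]
  refine integral_mono (.of_bound (measurable_entropy_right hmeas).aestronglyMeasurable _
      (ae_of_all _ fun x => abs_entropy_le (B := A ^ 2) (by fun_prop) fun y => sq_mem_Icc (hA _)))
    ((Integrable.integral_prod_left ((integrable_map_measure
      (hQ.comp (continuous_gradient_of_contDiff hf)).aestronglyMeasurable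
      (by fun_prop)).1 hint)).const_mul 2) fun x => ?_
  have htranslate := h (fun y => f (y + x)) (hf.comp (contDiff_id.add contDiff_const))
    ⟨A, fun z => hA _⟩ ⟨B, fun z => by rw [gradient_comp_add_const]; exact hB _⟩
  simp only [gradient_comp_add_const] at htranslate
  simpa only [add_comm _ x] using htranslate

theorem FormLSI.conv (hμ : FormLSI μ Q) (hν : FormLSI ν Q') (hQ : Continuous Q)
    (hQ' : Continuous Q') : FormLSI (μ ∗ ν) fun ξ => Q ξ + Q' ξ := by
  have := FiniteDimensional.proper_real F
  intro f hf hb hb'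
  obtain ⟨A, hA⟩ := hb
  have hleft := hμ.integral_entropy_translate_le (μ := ν) hQ hf ⟨A, hA⟩ hb'
  rw [Measure.conv_comm ν μ] at hleft
  have hswap : ∫ y, entropy μ (fun x => f (y + x) ^ 2) ∂ν
      = ∫ y, entropy μ (fun x => f (x + y) ^ 2) ∂ν := by simp only [add_comm]
  have hright := hν.integral_entropy_translate_le (μ := μ) hQ' hf ⟨A, hA⟩ hb'
  have htensor := entropy_conv_le (μ := μ) (ν := ν) (hf.continuous.measurable.pow_const 2)
    fun z => sq_mem_Icc (hA z)
  rw [integral_add (integrable_comp_gradient hQ hf hb') (integrable_comp_gradient hQ' hf hb')]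
  linarith

lemma SatisfiesLSI.conv {C D : ℝ} (hμ : SatisfiesLSI μ C) (hν : SatisfiesLSI ν D) :
    SatisfiesLSI (μ ∗ ν) (C + D) := by
  rw [← formLSI_iff_satisfiesLSI] at *
  simpa only [add_mul] using hμ.conv hν (by fun_prop) (by fun_prop)

lemma exists_covarianceBilin_self_eq_sum_inner_sq (ν : Measure F) :
    ∃ (n : ℕ) (e : Fin n → F), ∀ ξ, covarianceBilin ν ξ ξ = ∑ j, inner ℝ ξ (e j) ^ 2 := by
  have hT : (InnerProductSpace.continuousLinearMapOfBilin (covarianceBilin ν)).IsPositive := by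
    refine ⟨fun x y => ?_, fun x => ?_⟩
    · rw [ContinuousLinearMap.coe_coe, InnerProductSpace.continuousLinearMapOfBilin_apply,
        real_inner_comm, InnerProductSpace.continuousLinearMapOfBilin_apply, covarianceBilin_comm]
    · rw [ContinuousLinearMap.reApplyInnerSelf_apply, RCLike.re_to_real,
        InnerProductSpace.continuousLinearMapOfBilin_apply]
      exact covarianceBilin_self_nonneg x
  obtain ⟨n, e, he⟩ := ContinuousLinearMap.isPositive_iff_eq_sum_rankOne.1 hT
  refine ⟨n, e, fun ξ => ?_⟩
  rw [← InnerProductSpace.continuousLinearMapOfBilin_apply, he]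
  simp [sum_inner, real_inner_smul_right, pow_two, real_inner_comm]

omit [CompleteSpace F] [FiniteDimensional ℝ F] in
lemma charFun_gaussianReal_smul (e t : F) :
    charFun ((gaussianReal 0 1).map fun s : ℝ => s • e) t
      = Complex.exp (-(inner ℝ t e ^ 2 : ℝ) / 2) := by
  have hreal := charFun_gaussianReal (μ := 0) (v := 1) (inner ℝ t e)
  rw [charFun_apply_real] at hreal
  rw [charFun_apply, integral_map (by fun_prop) (by fun_prop)]
  simp only [real_inner_smul_left, real_inner_comm t e]
  push_cast at hreal ⊢
  simp only [mul_comm (inner ℝ t e : ℂ)] at hreal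
  rw [hreal]
  congr 1
  simp
  ring

lemma exists_formLSI_charFun_eq (a : F) {n : ℕ} (e : Fin n → F) :
    ∃ ν : Measure F, IsProbabilityMeasure ν ∧ FormLSI ν (fun ξ => ∑ j, inner ℝ ξ (e j) ^ 2) ∧
      ∀ t, charFun ν t
        = Complex.exp (inner ℝ t a * Complex.I - (∑ j, inner ℝ t (e j) ^ 2 : ℝ) / 2) := by
  induction n with
  | zero =>
    exact ⟨.dirac a, inferInstance, by simpa using formLSI_dirac a, fun t => by
      simp [charFun_dirac, real_inner_comm]⟩
  | succ n ih =>
    obtain ⟨ν, _, hν, hchar⟩ := ih (Fin.tail e)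
    have : IsProbabilityMeasure ((gaussianReal 0 1).map fun s : ℝ => s • e 0) :=
      Measure.isProbabilityMeasure_map (by fun_prop)
    have := FiniteDimensional.proper_real F
    refine ⟨(gaussianReal 0 1).map (fun s : ℝ => s • e 0) ∗ ν, inferInstance, ?_, fun t => ?_⟩
    · simp only [Fin.sum_univ_succ]
      exact (formLSI_gaussianReal_smul (e 0)).conv hν (by fun_prop) (by fun_prop)
    · rw [charFun_conv, charFun_gaussianReal_smul, hchar, ← Complex.exp_add, Fin.sum_univ_succ]
      congr 1
      simp only [Fin.tail]
      push_cast
      ring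

theorem formLSI_covarianceBilin (ν : Measure F) [IsGaussian ν] :
    FormLSI ν fun ξ => covarianceBilin ν ξ ξ := by
  obtain ⟨n, e, he⟩ := exists_covarianceBilin_self_eq_sum_inner_sq ν
  obtain ⟨ν', _, hν', hchar⟩ := exists_formLSI_charFun_eq ν[id] e
  have heq : ν = ν' := Measure.ext_of_charFun <| funext fun t => by
    rw [IsGaussian.charFun_eq', hchar, he]
  simpa only [he, ← heq] using hν'

theorem satisfiesLSI_of_hasGaussianLaw {Ω : Type*} [MeasurableSpace Ω] {P : Measure Ω}
    {X : Ω → F} (hX : HasGaussianLaw X P) {C : ℝ}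
    (hC : ∀ ξ, Var[fun ω => inner ℝ ξ (X ω); P] ≤ C * ‖ξ‖ ^ 2) : SatisfiesLSI (P.map X) C := by
  have := FiniteDimensional.proper_real F
  have := hX.isGaussian_map
  refine formLSI_iff_satisfiesLSI.1 ((formLSI_covarianceBilin _).mono (by fun_prop) (by fun_prop)
    fun ξ => ?_)
  rw [covarianceBilin_self IsGaussian.memLp_two_id, variance_map (by fun_prop) hX.aemeasurable]
  exact hC ξ

end FormLSI

/-! ### Log-Sobolev inequalities under Lipschitz maps -/

lemma exists_contDiffBump_tendsto {F : Type*} [NormedAddCommGroup F] :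
    ∃ φ : ℕ → ContDiffBump (0 : F), Tendsto (fun n => (φ n).rOut) atTop (𝓝 0) :=
  ⟨fun n => ⟨1 / (n + 1) / 2, 1 / (n + 1), by positivity, half_lt_self (by positivity)⟩,
    tendsto_one_div_add_atTop_nhds_zero_nat⟩

section Mollify

variable {F : Type*} [NormedAddCommGroup F] [InnerProductSpace ℝ F] [MeasurableSpace F]
  [BorelSpace F] [FiniteDimensional ℝ F]

/-- The mollification of a function by a normalized bump function: a `C¹` approximation which
preserves bounds and local Lipschitz constants. -/
noncomputable def mollify (φ : ContDiffBump (0 : F)) (T : F → ℝ) : F → ℝ :=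
  convolution (φ.normed Measure.addHaar) T (ContinuousLinearMap.lsmul ℝ ℝ) Measure.addHaar

variable (φ : ContDiffBump (0 : F)) {T : F → ℝ}

lemma mollify_apply (z : F) :
    mollify φ T z = ∫ y, φ.normed Measure.addHaar y * T (z - y) ∂Measure.addHaar := rfl

lemma contDiff_mollify (hT : Continuous T) : ContDiff ℝ 1 (mollify φ T) :=
  φ.hasCompactSupport_normed.contDiff_convolution_left _ φ.contDiff_normed hT.locallyIntegrable

lemma integrable_normed_mul (hT : Continuous T) (z : F) :
    Integrable (fun y => φ.normed Measure.addHaar y * T (z - y)) Measure.addHaar :=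
  (φ.continuous_normed.mul (hT.comp (continuous_sub_left z))).integrable_of_hasCompactSupport
    φ.hasCompactSupport_normed.mul_right

lemma abs_integral_normed_mul_le {D : ℝ} {S : F → ℝ} (hD : ∀ y, ‖y‖ < φ.rOut → |S y| ≤ D) :
    |∫ y, φ.normed Measure.addHaar y * S y ∂Measure.addHaar| ≤ D := by
  have hle : ∀ y, ‖φ.normed Measure.addHaar y * S y‖ ≤ φ.normed Measure.addHaar y * D := by
    intro y
    rw [norm_mul, Real.norm_of_nonneg (φ.nonneg_normed y)]
    rcases lt_or_ge ‖y‖ φ.rOut with hy | hy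
    · exact mul_le_mul_of_nonneg_left (hD y hy) (φ.nonneg_normed y)
    · have hzero : φ.normed Measure.addHaar y = 0 := by
        rw [← Function.notMem_support, φ.support_normed_eq]
        simpa using hy
      simp only [hzero, zero_mul, le_refl]
  simpa [integral_mul_const, φ.integral_normed] using
    norm_integral_le_of_norm_le (φ.integrable_normed.mul_const D) (ae_of_all _ hle)

lemma abs_mollify_le {B : ℝ} (hB : ∀ z, |T z| ≤ B) (z : F) : |mollify φ T z| ≤ B :=
  abs_integral_normed_mul_le φ fun _ _ => hB _

lemma norm_gradient_mollify_le [CompleteSpace F] (hT : Continuous T) {D : NNReal} {z : F}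
    (h : LipschitzOnWith D T (Metric.ball z (2 * φ.rOut))) : ‖gradient (mollify φ T) z‖ ≤ D := by
  rw [gradient, LinearIsometryEquiv.norm_map]
  refine norm_fderiv_le_of_lip' ℝ D.2 ?_
  filter_upwards [Metric.ball_mem_nhds z φ.rOut_pos] with x hx
  rw [mollify_apply, mollify_apply,
    ← integral_sub (integrable_normed_mul φ hT x) (integrable_normed_mul φ hT z)]
  simp only [← mul_sub]
  refine abs_integral_normed_mul_le φ fun y hy => ?_
  have hxy : x - y ∈ Metric.ball z (2 * φ.rOut) := by
    rw [mem_ball_iff_norm] at hx ⊢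
    rw [sub_right_comm]
    linarith [norm_sub_le (x - z) y]
  have hzy : z - y ∈ Metric.ball z (2 * φ.rOut) := by
    rw [mem_ball_iff_norm, sub_sub_cancel_left, norm_neg]
    linarith [φ.rOut_pos]
  simpa [Real.dist_eq, dist_eq_norm] using h.dist_le_mul _ hxy _ hzy

end Mollify

section Lipschitz

lemma tendsto_integral_max_sq {α ι : Type*} [MeasurableSpace α] {μ : Measure α}
    [IsFiniteMeasure μ] {l : Filter ι} [l.IsCountablyGenerated] {u : ι → α → ℝ} {b : α → ℝ} {B : ℝ}
    (hu : ∀ i, Measurable (u i)) (hb : Measurable b) (huB : ∀ i z, u i z ∈ Set.Icc 0 B)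
    (hbB : ∀ z, b z ∈ Set.Icc 0 B) (hlim : ∀ z a, b z < a → ∀ᶠ i in l, u i z < a) :
    Tendsto (fun i => ∫ z, max (u i z) (b z) ^ 2 ∂μ) l (𝓝 (∫ z, b z ^ 2 ∂μ)) := by
  refine tendsto_integral_filter_of_dominated_convergence (fun _ => B ^ 2)
    (.of_forall fun i => (((hu i).max hb).pow_const 2).aestronglyMeasurable)
    (.of_forall fun i => ae_of_all _ fun z => ?_) (integrable_const _)
    (ae_of_all _ fun z => Tendsto.pow ?_ 2)
  · rw [Real.norm_of_nonneg (sq_nonneg _)]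
    exact pow_le_pow_left₀ (le_max_of_le_right (hbB z).1) (max_le (huB i z).2 (hbB z).2) 2
  · exact tendsto_order.2 ⟨fun a ha => .of_forall fun i => lt_max_of_lt_right ha,
      fun a ha => (hlim z a ha).mono fun i hi => max_lt hi ha⟩

variable {F G : Type*} [NormedAddCommGroup F] [InnerProductSpace ℝ F] [CompleteSpace F]
  [MeasurableSpace F] [BorelSpace F] [NormedAddCommGroup G] [InnerProductSpace ℝ G]
  [CompleteSpace G] {μ : Measure F} [IsProbabilityMeasure μ] {C : ℝ}

lemma SatisfiesLSI.nonneg [Nontrivial F] (h : SatisfiesLSI μ C) : 0 ≤ C := by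
  obtain ⟨e, he⟩ := exists_norm_eq F zero_le_one
  have hgrad : ∀ z, gradient (fun z : F => Real.arctan (inner ℝ e z)) z
      = (1 / (1 + inner ℝ e z ^ 2)) • e := fun z => by
    have hderiv : HasFDerivAt (fun z : F => Real.arctan (inner ℝ e z))
        ((1 / (1 + inner ℝ e z ^ 2)) • innerSL ℝ e) z := (innerSL ℝ e).hasFDerivAt.arctan
    refine ext_inner_right ℝ fun w => ?_
    rw [inner_gradient_left, hderiv.fderiv, real_inner_smul_left]
    rfl
  have hnorm : ∀ z, ‖gradient (fun z : F => Real.arctan (inner ℝ e z)) z‖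
      = 1 / (1 + inner ℝ e z ^ 2) := fun z => by
    rw [hgrad, norm_smul, he, mul_one, Real.norm_of_nonneg (by positivity)]
  have hpos : ∀ z, 0 < 1 / (1 + inner ℝ e z ^ 2) := fun z => by positivity
  have hle : ∀ z, 1 / (1 + inner ℝ e z ^ 2) ≤ 1 := fun z =>
    div_le_one_of_le₀ (by linarith [sq_nonneg (inner ℝ e z)]) (by positivity)
  have habs : ∀ z, |Real.arctan (inner ℝ e z)| ≤ Real.pi / 2 := fun z =>
    abs_le.2 ⟨(Real.neg_pi_div_two_lt_arctan _).le, (Real.arctan_lt_pi_div_two _).le⟩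
  have hent : 0 ≤ entropy μ fun z => Real.arctan (inner ℝ e z) ^ 2 :=
    entropy_nonneg (by fun_prop) fun z => sq_mem_Icc (habs z)
  have hlsi := h _ (innerSL ℝ e).contDiff.arctan ⟨_, habs⟩ ⟨1, fun z => (hnorm z).trans_le (hle z)⟩
  simp only [innerSL_apply_apply, hnorm] at hlsi
  have hint : 0 < ∫ z, (1 / (1 + inner ℝ e z ^ 2)) ^ 2 ∂μ := by
    have hsq : ∀ z, 0 < (1 / (1 + inner ℝ e z ^ 2)) ^ 2 := fun z => pow_pos (hpos z) 2
    refine (integral_pos_iff_support_of_nonneg (fun z => (hsq z).le) ?_).2 ?_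
    · exact .of_mem_Icc 0 1 (by fun_prop) (ae_of_all _ fun z =>
        ⟨(hsq z).le, pow_le_one₀ (hpos z).le (hle z)⟩)
    · rw [Set.eq_univ_of_forall (s := Function.support _) fun z => (hsq z).ne']
      simp
  linarith [nonneg_of_mul_nonneg_left (hent.trans hlsi) hint]

variable {f : G → ℝ} {Φ : F → G} {K : NNReal}

lemma lipschitzOnWith_of_norm_gradient_le (hf : Differentiable ℝ f) {s : Set G} (hs : Convex ℝ s)
    {B : NNReal} (hB : ∀ w ∈ s, ‖gradient f w‖ ≤ B) : LipschitzOnWith B f s :=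
  hs.lipschitzOnWith_of_nnnorm_fderiv_le (𝕜 := ℝ) (fun w _ => hf w) fun w hw =>
    NNReal.coe_le_coe.1 <| by simpa [gradient] using hB w hw

variable [FiniteDimensional ℝ F]

lemma norm_gradient_mollify_comp_le (φ : ContDiffBump (0 : F)) (hf : Differentiable ℝ f)
    (hΦ : LipschitzWith K Φ) {B : NNReal} (hB : ∀ w, ‖gradient f w‖ ≤ B) (z : F) :
    ‖gradient (mollify φ (f ∘ Φ)) z‖ ≤ B * K := by
  have hlip := (lipschitzOnWith_of_norm_gradient_le hf convex_univ fun w _ => hB w).comp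
    (hΦ.lipschitzOnWith (s := Metric.ball z (2 * φ.rOut))) (Set.mapsTo_univ _ _)
  exact_mod_cast norm_gradient_mollify_le φ (hf.continuous.comp hΦ.continuous) hlip

lemma eventually_norm_gradient_mollify_comp_lt {ι : Type*} {l : Filter ι}
    {φ : ι → ContDiffBump (0 : F)} (hφ : Tendsto (fun i => (φ i).rOut) l (𝓝 0))
    (hf : ContDiff ℝ 1 f) (hΦ : LipschitzWith K Φ) {z : F} {a : ℝ}
    (ha : ‖gradient f (Φ z)‖ * K < a) :
    ∀ᶠ i in l, ‖gradient (mollify (φ i) (f ∘ Φ)) z‖ < a := by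
  have hfd := hf.differentiable one_ne_zero
  obtain ⟨c, hc, hca⟩ : ∃ c : NNReal, ‖gradient f (Φ z)‖ < c ∧ c * K < a := by
    have hnear : ∀ᶠ c : NNReal in 𝓝 ‖gradient f (Φ z)‖₊, (c : ℝ) * K < a :=
      ((NNReal.continuous_coe.mul continuous_const).tendsto _).eventually_lt_const ha
    obtain ⟨c, hca, hc⟩ := ((hnear.filter_mono nhdsWithin_le_nhds).and
      (self_mem_nhdsWithin (s := Set.Ioi ‖gradient f (Φ z)‖₊))).exists
    exact ⟨c, hc, hca⟩
  obtain ⟨ε, hε, hball⟩ := Metric.eventually_nhds_iff_ball.1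
    ((continuous_gradient_of_contDiff hf).norm.tendsto (Φ z) |>.eventually_lt_const hc)
  obtain ⟨δ, hδ, hmaps⟩ := Metric.continuousAt_iff.1 (hΦ.continuous.continuousAt (x := z)) ε hε
  have hsmall : ∀ᶠ i in l, 2 * (φ i).rOut < δ :=
    (hφ.const_mul 2).eventually_lt_const (by simpa using hδ)
  filter_upwards [hsmall] with i hi
  have hlip := (lipschitzOnWith_of_norm_gradient_le hfd (convex_ball (Φ z) ε)
    fun w hw => (hball w hw).le).comp (hΦ.lipschitzOnWith (s := Metric.ball z (2 * (φ i).rOut)))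
    fun x hx => hmaps ((Metric.mem_ball.1 hx).trans hi)
  have hle := norm_gradient_mollify_le (φ i) (hfd.continuous.comp hΦ.continuous) hlip
  exact hle.trans_lt (by exact_mod_cast hca)

-- `f ∘ Φ` is only Lipschitz, so the inequality is applied to its mollifications `T n`; the upper
-- limit of `|∇(T n)|` at `z` is at most `K |∇f (Φ z)|`.
lemma SatisfiesLSI.entropy_comp_sq_le (h : SatisfiesLSI μ C) (hC : 0 ≤ C)
    (hΦ : LipschitzWith K Φ) (hf : ContDiff ℝ 1 f) (hb : ∃ A, ∀ w, |f w| ≤ A)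
    (hb' : ∃ B, ∀ w, ‖gradient f w‖ ≤ B) :
    entropy μ (fun z => f (Φ z) ^ 2) ≤ 2 * C * ∫ z, (‖gradient f (Φ z)‖ * K) ^ 2 ∂μ := by
  obtain ⟨A, hA⟩ := hb
  obtain ⟨B, hB⟩ : ∃ B : NNReal, ∀ w, ‖gradient f w‖ ≤ B :=
    hb'.elim fun B hB => ⟨B.toNNReal, fun w => (hB w).trans (Real.le_coe_toNNReal B)⟩
  obtain ⟨φ, hφ⟩ := exists_contDiffBump_tendsto (F := F)
  have hcont : Continuous (f ∘ Φ) := hf.continuous.comp hΦ.continuous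
  have hT : ∀ n, ContDiff ℝ 1 (mollify (φ n) (f ∘ Φ)) := fun n => contDiff_mollify _ hcont
  have hTA : ∀ n z, |mollify (φ n) (f ∘ Φ) z| ≤ A := fun n => abs_mollify_le _ fun z => hA _
  have hTB : ∀ n z, ‖gradient (mollify (φ n) (f ∘ Φ)) z‖ ≤ B * K := fun n =>
    norm_gradient_mollify_comp_le _ (hf.differentiable one_ne_zero) hΦ hB
  have hTm : ∀ n, Measurable fun z => ‖gradient (mollify (φ n) (f ∘ Φ)) z‖ := fun n =>
    (continuous_gradient_of_contDiff (hT n)).norm.measurable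
  have hbm : Measurable fun z => ‖gradient f (Φ z)‖ * K :=
    (((continuous_gradient_of_contDiff hf).comp hΦ.continuous).norm.mul continuous_const).measurable
  have hbB : ∀ z, ‖gradient f (Φ z)‖ * K ∈ Set.Icc 0 (B * K : ℝ) := fun z =>
    ⟨by positivity, mul_le_mul_of_nonneg_right (hB _) K.2⟩
  have hentropy : Tendsto (fun n => entropy μ fun z => mollify (φ n) (f ∘ Φ) z ^ 2) atTop
      (𝓝 (entropy μ fun z => f (Φ z) ^ 2)) :=
    tendsto_entropy (fun n => (hT n).continuous.measurable.pow_const 2)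
      (.of_forall fun n z => sq_mem_Icc (hTA n z))
      fun z => (ContDiffBump.convolution_tendsto_right_of_continuous hφ hcont z).pow 2
  have henergy := (tendsto_integral_max_sq (μ := μ) hTm hbm
    (fun n z => ⟨norm_nonneg _, hTB n z⟩) hbB
    fun z a ha => eventually_norm_gradient_mollify_comp_lt hφ hf hΦ ha).const_mul (2 * C)
  refine le_of_tendsto_of_tendsto' hentropy henergy fun n =>
    (h _ (hT n) ⟨A, hTA n⟩ ⟨_, hTB n⟩).trans (mul_le_mul_of_nonneg_left ?_ (by positivity))
  refine integral_mono_of_nonneg (ae_of_all _ fun z => sq_nonneg _)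
    (.of_mem_Icc 0 ((B * K) ^ 2) (((hTm n).max hbm).pow_const 2).aemeasurable
      (ae_of_all _ fun z => ⟨sq_nonneg _, ?_⟩))
    (ae_of_all _ fun z => pow_le_pow_left₀ (norm_nonneg _) (le_max_left _ _) 2)
  exact pow_le_pow_left₀ (le_max_of_le_right (hbB z).1) (max_le (hTB n z) (hbB z).2) 2

theorem SatisfiesLSI.map_lipschitz [MeasurableSpace G] [BorelSpace G] (h : SatisfiesLSI μ C)
    (hC : 0 ≤ C) (hΦ : LipschitzWith K Φ) : SatisfiesLSI (μ.map Φ) (K ^ 2 * C) := by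
  intro f hf hb hb'
  have hgrad : Continuous fun z => ‖gradient f z‖ ^ 2 :=
    (continuous_gradient_of_contDiff hf).norm.pow 2
  rw [entropy_map hΦ.continuous.measurable (hf.continuous.measurable.pow_const 2),
    integral_map hΦ.continuous.measurable.aemeasurable hgrad.aestronglyMeasurable]
  refine (h.entropy_comp_sq_le hC hΦ hf hb hb').trans_eq ?_
  simp only [mul_pow, integral_mul_const]
  ring

end Lipschitz

/-! ### Cocoercive vector fields -/

section Cocoercive

variable {E : Type*} [NormedAddCommGroup E] [InnerProductSpace ℝ E]

/-- Cocoercivity in the sense of Baillon and Haddad, with the normalization in which the gradient of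
a convex function with `K`-Lipschitz gradient is cocoercive with constant `K`. -/
def Cocoercive (b : E → E) (K : ℝ) : Prop :=
  ∀ x y, ‖b x - b y‖ ^ 2 ≤ K * inner ℝ (b x - b y) (x - y)

/-- Monotonicity in the sense of operators on a Hilbert space. -/
def MonotoneFieldOn (b : E → E) (s : Set E) : Prop :=
  ∀ x ∈ s, ∀ y ∈ s, 0 ≤ inner ℝ (b x - b y) (x - y)

lemma Cocoercive.monotoneFieldOn_univ {b : E → E} {K : ℝ} (hb : Cocoercive b K) (hK : 0 < K) :
    MonotoneFieldOn b Set.univ :=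
  fun x _ y _ => nonneg_of_mul_nonneg_right ((sq_nonneg _).trans (hb x y)) hK

section Increments

variable {A B Δ : E} {α β : ℝ}

-- In this form cocoercivity is a Lipschitz bound, so that constants add by the triangle inequality.
lemma norm_sq_le_mul_inner_iff (hα : 0 ≤ α) :
    ‖A‖ ^ 2 ≤ α * inner ℝ A Δ ↔ ‖(2 : ℝ) • A - α • Δ‖ ≤ α * ‖Δ‖ := by
  rw [← sq_le_sq₀ (norm_nonneg _) (by positivity), norm_sub_sq_real, norm_smul, norm_smul,
    real_inner_smul_left, real_inner_smul_right, Real.norm_of_nonneg zero_le_two,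
    Real.norm_of_nonneg hα]
  constructor <;> intro h <;> linarith

lemma norm_add_sq_le_mul_inner (hα : 0 ≤ α) (hβ : 0 ≤ β) (hA : ‖A‖ ^ 2 ≤ α * inner ℝ A Δ)
    (hB : ‖B‖ ^ 2 ≤ β * inner ℝ B Δ) : ‖A + B‖ ^ 2 ≤ (α + β) * inner ℝ (A + B) Δ := by
  rw [norm_sq_le_mul_inner_iff (add_nonneg hα hβ)]
  rw [norm_sq_le_mul_inner_iff hα] at hA
  rw [norm_sq_le_mul_inner_iff hβ] at hB
  calc ‖(2 : ℝ) • (A + B) - (α + β) • Δ‖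
      = ‖((2 : ℝ) • A - α • Δ) + ((2 : ℝ) • B - β • Δ)‖ := by congr 1; module
    _ ≤ (α + β) * ‖Δ‖ := by rw [add_mul]; exact norm_add_le_of_le hA hB

lemma norm_sq_le_mul_inner_of_le (hα : 0 ≤ α) (hαβ : α ≤ β) (hA : ‖A‖ ^ 2 ≤ α * inner ℝ A Δ) :
    ‖A‖ ^ 2 ≤ β * inner ℝ A Δ := by
  simpa using norm_add_sq_le_mul_inner (B := 0) hα (sub_nonneg.2 hαβ) hA (by simp)

lemma norm_smul_add_sq_le_mul_inner (hα : 0 ≤ α) (hA : ‖A‖ ≤ α * ‖Δ‖) :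
    ‖α • Δ + A‖ ^ 2 ≤ 2 * α * inner ℝ (α • Δ + A) Δ := by
  rw [norm_sq_le_mul_inner_iff (by positivity)]
  calc ‖(2 : ℝ) • (α • Δ + A) - (2 * α) • Δ‖ = 2 * ‖A‖ := by
        rw [show (2 : ℝ) • (α • Δ + A) - (2 * α) • Δ = (2 : ℝ) • A by module, norm_smul,
          Real.norm_of_nonneg zero_le_two]
    _ ≤ 2 * α * ‖Δ‖ := by linarith

lemma norm_smul_sq_le_mul_inner {t : ℝ} (ht : 0 ≤ t) (hA : ‖A‖ ^ 2 ≤ α * inner ℝ A Δ) :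
    ‖t • A‖ ^ 2 ≤ t * α * inner ℝ (t • A) Δ := by
  rw [norm_smul, Real.norm_of_nonneg ht, mul_pow, real_inner_smul_left]
  linarith [mul_le_mul_of_nonneg_left hA (sq_nonneg t)]

end Increments

lemma Cocoercive.add {b c : E → E} {K K' : ℝ} (hb : Cocoercive b K) (hc : Cocoercive c K')
    (hK : 0 ≤ K) (hK' : 0 ≤ K') : Cocoercive (fun x => b x + c x) (K + K') := fun x y => by
  simpa only [add_sub_add_comm] using norm_add_sq_le_mul_inner hK hK' (hb x y) (hc x y)

lemma Cocoercive.mono {b : E → E} {K K' : ℝ} (hb : Cocoercive b K) (hK : 0 ≤ K) (hKK' : K ≤ K') :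
    Cocoercive b K' := fun x y => norm_sq_le_mul_inner_of_le hK hKK' (hb x y)

lemma cocoercive_const_smul (m : ℝ) : Cocoercive (fun x : E => m • x) m := fun x y => by
  rw [← smul_sub, norm_smul, mul_pow, Real.norm_eq_abs, sq_abs, real_inner_smul_left,
    real_inner_self_eq_norm_sq]
  exact le_of_eq (by ring)

end Cocoercive

section LocalToGlobal

lemma monotone_of_eventually_le_nhdsGT {f : ℝ → ℝ} (hf : Continuous f) {S : Set ℝ}
    (hS : S.Finite) (hloc : ∀ τ ∉ S, ∀ᶠ s in 𝓝[>] τ, f τ ≤ f s) : Monotone f := by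
  intro a b hab
  by_contra! hlt
  -- A level that `f` does not attain on `S` cannot be crossed downwards.
  obtain ⟨c, hc, hcS⟩ := ((Set.Ioo_infinite hlt).sdiff (hS.image f)).nonempty
  have hsub : Set.Icc a b ⊆ {x | c ≤ f x} := by
    refine ((isClosed_le continuous_const hf).inter
      isClosed_Icc).Icc_subset_of_forall_mem_nhdsWithin hc.2.le fun τ hτ => ?_
    rcases (show c ≤ f τ from hτ.1).eq_or_lt with heq | hgt
    · filter_upwards [hloc τ fun hτS => hcS ⟨τ, hτS, heq.symm⟩] with s hs
      exact heq.trans_le hs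
    · exact mem_nhdsWithin_of_mem_nhds ((continuous_const.continuousAt.eventually_lt
        hf.continuousAt hgt).mono fun _ => le_of_lt)
  exact (hsub (Set.right_mem_Icc.2 hab)).not_gt hc.1

variable {E F : Type*} [NormedAddCommGroup E] [InnerProductSpace ℝ E] [NormedAddCommGroup F]
  [InnerProductSpace ℝ F]

lemma finite_setOf_norm_add_smul_eq {Δ : E} (hΔ : Δ ≠ 0) (y : E) (ρ : ℝ) :
    {τ : ℝ | ‖y + τ • Δ‖ = ρ}.Finite := by
  let p : Polynomial ℝ := .C (‖Δ‖ ^ 2) * .X ^ 2 + .C (2 * inner ℝ y Δ) * .X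
    + .C (‖y‖ ^ 2 - ρ ^ 2)
  have hΔsq : ‖Δ‖ ^ 2 ≠ 0 := pow_ne_zero _ (norm_ne_zero_iff.2 hΔ)
  have hp : p ≠ 0 := Polynomial.leadingCoeff_ne_zero.1
    (by rwa [Polynomial.leadingCoeff_quadratic hΔsq])
  refine (p.rootSet_finite ℝ).subset fun τ hτ => (Polynomial.mem_rootSet.2 ⟨hp, ?_⟩)
  have hsq : ‖y + τ • Δ‖ ^ 2 = ρ ^ 2 := by rw [show ‖y + τ • Δ‖ = ρ from hτ]
  rw [norm_add_sq_real, norm_smul, real_inner_smul_right, mul_pow, Real.norm_eq_abs, sq_abs] at hsq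
  simp only [p, map_add, map_mul, Polynomial.aeval_C, Polynomial.aeval_X, map_pow,
    Algebra.algebraMap_self, RingHom.id_apply]
  linarith

theorem norm_sub_le_of_eventually_off_spheres {N : E → F} (hN : Continuous N) {K : ℝ}
    (hK : 0 ≤ K) {ρs : Set ℝ} (hρs : ρs.Finite)
    (hloc : ∀ x, ‖x‖ ∉ ρs → ∀ᶠ z in 𝓝 x, ‖N z - N x‖ ≤ K * ‖z - x‖) (x y : E) :
    ‖N x - N y‖ ≤ K * ‖x - y‖ := by
  rcases eq_or_ne x y with rfl | hxy
  · simp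
  set Δ := x - y
  set e := N x - N y with he
  have hS : {τ : ℝ | ‖y + τ • Δ‖ ∈ ρs}.Finite := by
    rw [show {τ : ℝ | ‖y + τ • Δ‖ ∈ ρs} = ⋃ ρ ∈ ρs, {τ | ‖y + τ • Δ‖ = ρ} by ext; simp]
    exact hρs.biUnion fun ρ _ => finite_setOf_norm_add_smul_eq (sub_ne_zero.2 hxy) y ρ
  have hline : Continuous fun τ : ℝ => y + τ • Δ := by fun_prop
  have hmono : Monotone fun τ : ℝ => K * ‖Δ‖ * ‖e‖ * τ - inner ℝ (N (y + τ • Δ)) e := by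
    refine monotone_of_eventually_le_nhdsGT (by fun_prop) hS fun τ hτ => ?_
    filter_upwards [(hline.continuousAt.eventually (hloc _ hτ)).filter_mono nhdsWithin_le_nhds,
      self_mem_nhdsWithin] with s hs hτs
    have hτs' : 0 ≤ s - τ := sub_nonneg.2 (Set.mem_Ioi.1 hτs).le
    rw [add_sub_add_left_eq_sub, ← sub_smul, norm_smul, Real.norm_of_nonneg hτs'] at hs
    have hinner := (real_inner_le_norm (N (y + s • Δ) - N (y + τ • Δ)) e).trans
      (mul_le_mul_of_nonneg_right hs (norm_nonneg e))
    rw [inner_sub_left] at hinner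
    linarith
  have h01 := hmono zero_le_one
  have hx : y + (1 : ℝ) • Δ = x := by simp [Δ]
  simp only [hx, zero_smul, add_zero, mul_zero, mul_one] at h01
  have hsq : ‖e‖ ^ 2 ≤ K * ‖Δ‖ * ‖e‖ := by
    rw [← real_inner_self_eq_norm_sq]
    nth_rewrite 1 [he]
    rw [inner_sub_left]
    linarith
  rcases (norm_nonneg e).eq_or_lt with h0 | h0
  · rw [← h0]
    positivity
  · exact le_of_mul_le_mul_right (by linarith) h0

theorem cocoercive_of_eventually_off_spheres {b : E → E} (hb : Continuous b) {K : ℝ} (hK : 0 ≤ K)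
    {ρs : Set ℝ} (hρs : ρs.Finite) (hloc : ∀ x, ‖x‖ ∉ ρs →
      ∀ᶠ z in 𝓝 x, ‖b z - b x‖ ^ 2 ≤ K * inner ℝ (b z - b x) (z - x)) : Cocoercive b K := by
  have hsub : ∀ x y, (2 : ℝ) • (b x - b y) - K • (x - y)
      = ((2 : ℝ) • b x - K • x) - ((2 : ℝ) • b y - K • y) := fun x y => by module
  intro x y
  simp only [norm_sq_le_mul_inner_iff hK, hsub] at hloc ⊢
  exact norm_sub_le_of_eventually_off_spheres (by fun_prop) hK hρs hloc x y

end LocalToGlobal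

section BaillonHaddad

variable {E : Type*} [NormedAddCommGroup E] [InnerProductSpace ℝ E] [CompleteSpace E]
  {φ : E → ℝ} {G : E → E} {U : Set E} {K : ℝ}

lemma hasGradientAt_add {φ' : E → ℝ} {g g' x : E} (h : HasGradientAt φ g x)
    (h' : HasGradientAt φ' g' x) : HasGradientAt (fun y => φ y + φ' y) (g + g') x := by
  rw [hasGradientAt_iff_hasFDerivAt, map_add]
  exact h.hasFDerivAt.add h'.hasFDerivAt

lemma hasGradientAt_sub {φ' : E → ℝ} {g g' x : E} (h : HasGradientAt φ g x)
    (h' : HasGradientAt φ' g' x) : HasGradientAt (fun y => φ y - φ' y) (g - g') x := by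
  rw [hasGradientAt_iff_hasFDerivAt, map_sub]
  exact h.hasFDerivAt.sub h'.hasFDerivAt

lemma hasGradientAt_half_mul_norm_sq (K : ℝ) (x : E) :
    HasGradientAt (fun y : E => K / 2 * ‖y‖ ^ 2) (K • x) x := by
  rw [hasGradientAt_iff_hasFDerivAt]
  refine ((hasStrictFDerivAt_norm_sq x).hasFDerivAt.const_mul (K / 2)).congr_fderiv ?_
  ext w
  simp
  ring

lemma add_inner_le_of_monotone_gradient (hU : Convex ℝ U) (hG : ∀ y ∈ U, HasGradientAt φ (G y) y)
    (hmono : MonotoneFieldOn G U) {x y : E} (hx : x ∈ U) (hy : y ∈ U) :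
    φ x + inner ℝ (G x) (y - x) ≤ φ y := by
  have hmem : ∀ τ ∈ Set.Icc (0 : ℝ) 1, x + τ • (y - x) ∈ U := fun τ hτ =>
    hU.add_smul_sub_mem hx hy hτ
  have hderiv : ∀ τ ∈ Set.Icc (0 : ℝ) 1, HasDerivAt (fun τ : ℝ => φ (x + τ • (y - x)))
      (inner ℝ (G (x + τ • (y - x))) (y - x)) τ := fun τ hτ =>
    hasDerivAt_comp_add_smul (hG _ (hmem τ hτ))
  obtain ⟨τ, hτ, hslope⟩ := exists_hasDerivAt_eq_slope _ _ zero_lt_one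
    (fun τ hτ => (hderiv τ hτ).continuousAt.continuousWithinAt)
    fun τ hτ => hderiv τ (Set.Ioo_subset_Icc_self hτ)
  have hinner := hmono _ (hmem τ (Set.Ioo_subset_Icc_self hτ)) x hx
  rw [add_sub_cancel_left, real_inner_smul_right, inner_sub_left] at hinner
  have := nonneg_of_mul_nonneg_right hinner hτ.1
  rw [hslope] at this
  simp only [one_smul, zero_smul, add_zero, add_sub_cancel, sub_zero, div_one] at this
  linarith

lemma le_add_inner_add_of_lipschitz_gradient (hU : Convex ℝ U)
    (hG : ∀ y ∈ U, HasGradientAt φ (G y) y)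
    (hlip : ∀ y ∈ U, ∀ z ∈ U, ‖G y - G z‖ ≤ K * ‖y - z‖) {x y : E} (hx : x ∈ U) (hy : y ∈ U) :
    φ y ≤ φ x + inner ℝ (G x) (y - x) + K / 2 * ‖y - x‖ ^ 2 := by
  have hmono : MonotoneFieldOn (fun y => K • y - G y) U := fun y hy z hz => by
    have hinner := (real_inner_le_norm (G y - G z) (y - z)).trans
      (mul_le_mul_of_nonneg_right (hlip y hy z hz) (norm_nonneg _))
    rw [sub_sub_sub_comm, ← smul_sub, inner_sub_left, real_inner_smul_left,
      real_inner_self_eq_norm_sq]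
    linarith
  have hle := add_inner_le_of_monotone_gradient hU
    (fun y hy => hasGradientAt_sub (hasGradientAt_half_mul_norm_sq K y) (hG y hy)) hmono hx hy
  have hsq := norm_add_sq_real x (y - x)
  rw [add_sub_cancel] at hsq
  rw [inner_sub_left, real_inner_smul_left, hsq] at hle
  linarith

/- The lower bound at `x` and the upper bound at `y`, compared at the point minimizing their
difference. -/
lemma add_inner_add_norm_sq_le (hK : 0 < K) (hU : Convex ℝ U)
    (hG : ∀ y ∈ U, HasGradientAt φ (G y) y) (hmono : MonotoneFieldOn G U)
    (hlip : ∀ y ∈ U, ∀ z ∈ U, ‖G y - G z‖ ≤ K * ‖y - z‖) {x y : E} (hx : x ∈ U) (hy : y ∈ U)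
    (hw : y - K⁻¹ • (G y - G x) ∈ U) :
    φ x + inner ℝ (G x) (y - x) + K⁻¹ / 2 * ‖G y - G x‖ ^ 2 ≤ φ y := by
  have hlow := add_inner_le_of_monotone_gradient hU hG hmono hx hw
  have hupp := le_add_inner_add_of_lipschitz_gradient hU hG hlip hy hw
  rw [sub_right_comm, inner_sub_right, real_inner_smul_right] at hlow
  rw [sub_sub_cancel_left, inner_neg_right, real_inner_smul_right, norm_neg, norm_smul,
    Real.norm_of_nonneg (inv_nonneg.2 hK.le)] at hupp
  have hD : K⁻¹ * inner ℝ (G y) (G y - G x) - K⁻¹ * inner ℝ (G x) (G y - G x)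
      = K⁻¹ * ‖G y - G x‖ ^ 2 := by
    rw [← mul_sub, ← inner_sub_left, real_inner_self_eq_norm_sq]
  have hsq : K / 2 * (K⁻¹ * ‖G y - G x‖) ^ 2 = K⁻¹ / 2 * ‖G y - G x‖ ^ 2 := by field_simp
  linarith

theorem eventually_norm_sq_le_mul_inner_of_gradient {x : E} (hU : U ∈ 𝓝 x)
    (hG : ∀ y ∈ U, HasGradientAt φ (G y) y) (hmono : MonotoneFieldOn G U)
    (hlip : ∀ y ∈ U, ∀ z ∈ U, ‖G y - G z‖ ≤ K * ‖y - z‖) :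
    ∀ᶠ z in 𝓝 x, ‖G z - G x‖ ^ 2 ≤ K * inner ℝ (G z - G x) (z - x) := by
  obtain ⟨ε, hε, hball⟩ := Metric.mem_nhds_iff.1 hU
  filter_upwards [Metric.ball_mem_nhds x (half_pos hε)] with z hz
  have hzx : ‖z - x‖ < ε / 2 := by rwa [← dist_eq_norm]
  have hxU : x ∈ Metric.ball x ε := Metric.mem_ball_self hε
  have hzU : z ∈ Metric.ball x ε := Metric.ball_subset_ball (half_le_self hε.le) hz
  have hle := hlip z (hball hzU) x (hball hxU)
  rcases le_or_gt K 0 with hK | hK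
  · have h0 : G z - G x = 0 :=
      norm_le_zero_iff.1 (hle.trans (mul_nonpos_of_nonpos_of_nonneg hK (norm_nonneg _)))
    simp [h0]
  have hstep : ‖K⁻¹ • (G z - G x)‖ ≤ ‖z - x‖ := by
    rwa [norm_smul, Real.norm_of_nonneg (inv_nonneg.2 hK.le), inv_mul_le_iff₀ hK]
  have hhalf : ∀ y ∈ Metric.ball x ε, ∀ y' ∈ Metric.ball x ε,
      y' - K⁻¹ • (G y' - G y) ∈ Metric.ball x ε →
      φ y + inner ℝ (G y) (y' - y) + K⁻¹ / 2 * ‖G y' - G y‖ ^ 2 ≤ φ y' := fun y hy y' hy' =>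
    add_inner_add_norm_sq_le hK (convex_ball x ε) (fun y hy => hG y (hball hy))
      (fun y hy z hz => hmono y (hball hy) z (hball hz))
      (fun y hy z hz => hlip y (hball hy) z (hball hz)) hy hy'
  have hforward := hhalf x hxU z hzU <| by
    rw [mem_ball_iff_norm, sub_right_comm]
    linarith [norm_sub_le (z - x) (K⁻¹ • (G z - G x))]
  have hbackward := hhalf z hzU x hxU <| by
    rw [mem_ball_iff_norm, sub_sub_cancel_left, norm_neg, ← neg_sub (G z), smul_neg, norm_neg]
    linarith
  rw [norm_sub_rev (G x), ← neg_sub z x, inner_neg_right] at hbackward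
  rw [← inv_mul_le_iff₀ hK, inner_sub_left]
  linarith

end BaillonHaddad

/-! ### Taming a monotone gradient -/

section Taming

variable {E : Type*} [NormedAddCommGroup E] [InnerProductSpace ℝ E]

/-- The field `g` tamed at radius `r` with strength `R`; the tamed drift is
`tamedField g r R + m id` for `g = h - m id`. -/
noncomputable def tamedField (g : E → E) (r R : ℝ) (x : E) : E :=
  cutoffT r ‖x‖ • g x + (R * cutoffS r ‖x‖) • x

section Regions

variable {g : E → E} {r R : ℝ} {x : E}

lemma tamedField_of_lt (hx : ‖x‖ < r - 2) : tamedField g r R x = g x := by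
  simp [tamedField, cutoffT, cutoffS, hx.le, (by linarith : ‖x‖ ≤ r - 1)]

lemma tamedField_of_mem_Ioo (hx : ‖x‖ ∈ Set.Ioo (r - 2) (r - 1)) :
    tamedField g r R x = g x + (R * (‖x‖ - (r - 2))) • x := by
  rw [tamedField, cutoffT, cutoffS, if_pos hx.2.le, if_neg hx.1.not_ge, if_pos hx.2, one_smul,
    sub_sub_eq_add_sub, add_sub_right_comm]

lemma tamedField_of_mem_annulus (hx : ‖x‖ ∈ Set.Ioo (r - 1) r) :
    tamedField g r R x = (r - ‖x‖) • g x + R • x := by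
  have := hx.1
  rw [tamedField, cutoffT, cutoffS, if_neg (by linarith), if_pos hx.2, if_neg (by linarith),
    if_neg (by linarith), if_pos hx.2.le, mul_one]

lemma tamedField_of_norm_eq (hx : ‖x‖ = r) : tamedField g r R x = R • x := by
  rw [tamedField, cutoffT, cutoffS, if_neg (by linarith), if_neg (by linarith),
    if_neg (by linarith), if_neg (by linarith), if_pos hx.le, mul_one, zero_smul, zero_add]

lemma tamedField_of_gt (hx : r < ‖x‖) : tamedField g r R x = (R * (r / ‖x‖)) • x := by
  rw [tamedField, cutoffT, cutoffS, if_neg (by linarith), if_neg (by linarith),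
    if_neg (by linarith), if_neg (by linarith), if_neg (by linarith), zero_smul, zero_add]

end Regions

section Lipschitz

/-- The radial retraction onto the closed ball of radius `r`; the junk value of `r / ‖x‖` at `x = 0`
is harmless. -/
noncomputable def radialRetraction (r : ℝ) (x : E) : E := min 1 (r / ‖x‖) • x

variable {r : ℝ}

omit [InnerProductSpace ℝ E] in
lemma min_one_div_mul_norm (hr : 0 ≤ r) (x : E) : min 1 (r / ‖x‖) * ‖x‖ = min ‖x‖ r := by
  rcases (norm_nonneg x).eq_or_lt with h | h
  · simp [← h, hr]
  · rw [min_mul_of_nonneg _ _ h.le, one_mul, div_mul_cancel₀ _ h.ne']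

lemma norm_radialRetraction_le (hr : 0 ≤ r) (x : E) : ‖radialRetraction r x‖ ≤ r := by
  rw [radialRetraction, norm_smul, Real.norm_of_nonneg (by positivity), min_one_div_mul_norm hr]
  exact min_le_right _ _

lemma radialRetraction_of_le {x : E} (hx : ‖x‖ ≤ r) : radialRetraction r x = x := by
  rcases eq_or_ne x 0 with rfl | h0
  · exact smul_zero _
  · rw [radialRetraction, min_eq_left ((one_le_div (norm_pos_iff.2 h0)).2 hx), one_smul]

lemma radialRetraction_of_gt (hr : 0 ≤ r) {x : E} (hx : r < ‖x‖) :
    radialRetraction r x = (r / ‖x‖) • x := by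
  rw [radialRetraction, min_eq_right ((div_le_one (hr.trans_lt hx)).2 hx.le)]

lemma lipschitzWith_radialRetraction (hr : 0 ≤ r) :
    LipschitzWith 2 (radialRetraction r : E → E) := by
  have hle : ∀ x y : E, ‖x‖ ≤ ‖y‖ →
      ‖radialRetraction r x - radialRetraction r y‖ ≤ 2 * ‖x - y‖ := by
    intro x y hxy
    set α := min 1 (r / ‖x‖)
    set β := min 1 (r / ‖y‖)
    have hβ0 : 0 ≤ β := by positivity
    have hβ1 : β ≤ 1 := min_le_left _ _
    have hradial : |(α - β) * ‖x‖| ≤ ‖x - y‖ := by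
      have hx := min_one_div_mul_norm hr x
      have hy := min_one_div_mul_norm hr y
      have hdist := (norm_sub_norm_le y x).trans_eq (norm_sub_rev y x)
      have hβx : β * ‖x‖ ≤ min ‖x‖ r := le_min (mul_le_of_le_one_left (norm_nonneg x) hβ1)
        ((mul_le_mul_of_nonneg_left hxy hβ0).trans (hy.trans_le (min_le_right _ _)))
      have hmin : min ‖x‖ r ≤ min ‖y‖ r := min_le_min_right r hxy
      rw [sub_mul, abs_of_nonneg (by linarith)]
      nlinarith
    calc ‖α • x - β • y‖ = ‖(α - β) • x + β • (x - y)‖ := by congr 1; module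
      _ ≤ ‖x - y‖ + 1 * ‖x - y‖ := norm_add_le_of_le
          (by rwa [norm_smul, Real.norm_eq_abs, ← abs_of_nonneg (norm_nonneg x), ← abs_mul])
          (by rw [norm_smul, Real.norm_of_nonneg hβ0]; gcongr)
      _ = 2 * ‖x - y‖ := by ring
  refine LipschitzWith.of_dist_le_mul fun x y => ?_
  simp only [dist_eq_norm, NNReal.coe_ofNat]
  rcases le_total ‖x‖ ‖y‖ with hxy | hxy
  · exact hle x y hxy
  · rw [norm_sub_rev, norm_sub_rev x]
    exact hle y x hxy

lemma lipschitzWith_smul_of_bounded {α : E → ℝ} {f : E → E} {A B K K' : NNReal}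
    (hα : LipschitzWith K α) (hαA : ∀ x, ‖α x‖ ≤ A) (hf : LipschitzWith K' f)
    (hfB : ∀ x, ‖f x‖ ≤ B) : LipschitzWith (K * B + A * K') fun x => α x • f x := by
  refine LipschitzWith.of_dist_le_mul fun x y => ?_
  simp only [dist_eq_norm, NNReal.coe_add, NNReal.coe_mul]
  calc ‖α x • f x - α y • f y‖ = ‖(α x - α y) • f x + α y • (f x - f y)‖ := by congr 1; module
    _ ≤ (K * ‖x - y‖) * B + A * (K' * ‖x - y‖) := by
        refine norm_add_le_of_le ?_ ?_ <;> rw [norm_smul]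
        · exact mul_le_mul (hα.norm_sub_le x y) (hfB x) (norm_nonneg _) (by positivity)
        · exact mul_le_mul (hαA y) (hf.norm_sub_le x y) (norm_nonneg _) A.coe_nonneg
    _ = (K * B + A * K') * ‖x - y‖ := by ring

omit [InnerProductSpace ℝ E] in
lemma lipschitzWith_max_min {α : E → ℝ} {K : NNReal} (hα : LipschitzWith K α) :
    LipschitzWith K fun x => max 0 (min 1 (α x)) :=
  (hα.const_min 1).const_max 0

lemma norm_max_min_le_one (t : ℝ) : ‖max 0 (min 1 t)‖ ≤ 1 := by
  rw [Real.norm_of_nonneg (le_max_left _ _)]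
  exact max_le zero_le_one (min_le_left _ _)

lemma cutoffT_smul_eq (r : ℝ) (g : E → E) (x : E) :
    cutoffT r ‖x‖ • g x = max 0 (min 1 (r - ‖x‖)) • g (radialRetraction r x) := by
  rcases lt_or_ge ‖x‖ r with hx | hx
  · rw [radialRetraction_of_le hx.le]
    congr 1
    rw [cutoffT]
    grind
  · rw [cutoffT, if_neg (by linarith), if_neg (by linarith),
      max_eq_left ((min_le_right _ _).trans (by linarith)), zero_smul, zero_smul]

lemma cutoffS_smul_eq (hr : 0 ≤ r) (x : E) :
    cutoffS r ‖x‖ • x = max 0 (min 1 (‖x‖ - r + 2)) • radialRetraction r x := by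
  rw [cutoffS]
  rcases le_or_gt ‖x‖ r with hx | hx
  · rw [radialRetraction_of_le hx]
    congr 1
    grind
  · rw [radialRetraction_of_gt hr hx, min_eq_left (by linarith), max_eq_right zero_le_one,
      one_smul, if_neg (by linarith), if_neg (by linarith), if_neg (by linarith)]

theorem exists_lipschitzWith_tamedField (hr : 0 ≤ r) {g : E → E} {G : NNReal}
    (hg : LipschitzOnWith G g (Metric.closedBall 0 r)) (R : ℝ) :
    ∃ K, LipschitzWith K (tamedField g r R) := by
  lift r to NNReal using hr
  have hmem : ∀ x : E, radialRetraction r x ∈ Metric.closedBall (0 : E) r := fun x =>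
    mem_closedBall_zero_iff.2 (norm_radialRetraction_le r.coe_nonneg x)
  have hretract := lipschitzWith_radialRetraction (E := E) r.coe_nonneg
  have hgP : LipschitzWith (G * 2) fun x => g (radialRetraction r x) :=
    lipschitzOnWith_univ.1 <| hg.comp (lipschitzOnWith_univ.2 hretract) fun x _ => hmem x
  have hgP_le : ∀ x, ‖g (radialRetraction r x)‖ ≤ (‖g 0‖₊ + G * r : NNReal) := fun x => by
    have hsub := hg.norm_sub_le (hmem x) (Metric.mem_closedBall_self r.coe_nonneg)
    rw [sub_zero] at hsub
    have := norm_sub_norm_le (g (radialRetraction r x)) (g 0)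
    have := mul_le_mul_of_nonneg_left (norm_radialRetraction_le r.coe_nonneg x) G.coe_nonneg
    simp only [NNReal.coe_add, coe_nnnorm, NNReal.coe_mul]
    linarith
  have hT : LipschitzWith 1 fun x : E => r - ‖x‖ := by
    simpa using (LipschitzWith.const (r : ℝ)).sub (lipschitzWith_one_norm (E := E))
  have hS : LipschitzWith 1 fun x : E => ‖x‖ - r + 2 := by
    simpa [sub_add] using (lipschitzWith_one_norm (E := E)).sub (LipschitzWith.const ((r : ℝ) - 2))
  have hfield : tamedField g r R = fun x => max 0 (min 1 (r - ‖x‖)) • g (radialRetraction r x)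
      + R • max 0 (min 1 (‖x‖ - r + 2)) • radialRetraction r x := funext fun x => by
    rw [tamedField, cutoffT_smul_eq, mul_smul, cutoffS_smul_eq r.coe_nonneg]
  rw [hfield]
  exact ⟨_, (lipschitzWith_smul_of_bounded (A := 1) (lipschitzWith_max_min hT)
      (fun _ => norm_max_min_le_one _) hgP hgP_le).add
    ((lipschitzWith_smul R).comp (lipschitzWith_smul_of_bounded (A := 1) (lipschitzWith_max_min hS)
      (fun _ => norm_max_min_le_one _) hretract (norm_radialRetraction_le r.coe_nonneg)))⟩

lemma le_of_lipschitzWith_of_eq_smul_on_sphere [Nontrivial E] (hr : 0 < r) {f : E → E} {c : ℝ}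
    {K : NNReal} (hf : LipschitzWith K f) (hc : ∀ x, ‖x‖ = r → f x = c • x) : c ≤ K := by
  obtain ⟨e, he⟩ := exists_norm_eq E hr.le
  have hlip := hf.norm_sub_le e (-e)
  rw [hc e he, hc (-e) (by rw [norm_neg, he]), ← smul_sub, norm_smul, sub_neg_eq_add,
    ← two_smul ℝ e, norm_smul, he] at hlip
  exact (le_abs_self c).trans (le_of_mul_le_mul_right hlip (by norm_num [hr]))

end Lipschitz

end Taming

section Cocoercivity

variable {E : Type*} [NormedAddCommGroup E] [InnerProductSpace ℝ E] [CompleteSpace E]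
  {g : E → E} {w : E → ℝ} {r R : ℝ}

section Radial

variable {Φ k : ℝ → ℝ} {I : Set ℝ}

lemma hasGradientAt_comp_norm {k : ℝ} {x : E} (hx : x ≠ 0) (hΦ : HasDerivAt Φ (k * ‖x‖) ‖x‖) :
    HasGradientAt (fun y => Φ ‖y‖) (k • x) x := by
  have hsq : ‖x‖ ^ 2 ≠ 0 := pow_ne_zero 2 (norm_ne_zero_iff.2 hx)
  rw [← Real.sqrt_sq (norm_nonneg x)] at hΦ
  have hcomp := (hΦ.comp (‖x‖ ^ 2) (Real.hasDerivAt_sqrt hsq)).comp_hasFDerivAt x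
    (hasStrictFDerivAt_norm_sq x).hasFDerivAt
  simp only [Function.comp_def, Real.sqrt_sq (norm_nonneg _)] at hcomp
  rw [hasGradientAt_iff_hasFDerivAt]
  refine hcomp.congr_fderiv ?_
  ext y
  have := norm_ne_zero_iff.2 hx
  simp
  field_simp

omit [CompleteSpace E] in
lemma monotoneFieldOn_radial (hk : ∀ ρ ∈ I, 0 ≤ k ρ) (hmono : MonotoneOn (fun ρ => k ρ * ρ) I) :
    MonotoneFieldOn (fun x : E => k ‖x‖ • x) {x | ‖x‖ ∈ I} := by
  intro x hx y hy
  have hnorms : 0 ≤ (k ‖x‖ * ‖x‖ - k ‖y‖ * ‖y‖) * (‖x‖ - ‖y‖) := by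
    rcases le_total ‖x‖ ‖y‖ with hxy | hxy
    · exact mul_nonneg_of_nonpos_of_nonpos (sub_nonpos.2 (hmono hx hy hxy)) (sub_nonpos.2 hxy)
    · exact mul_nonneg (sub_nonneg.2 (hmono hy hx hxy)) (sub_nonneg.2 hxy)
  have hx' := mul_le_mul_of_nonneg_left (real_inner_le_norm x y) (hk _ hx)
  have hy' := mul_le_mul_of_nonneg_left (real_inner_le_norm x y) (hk _ hy)
  simp only [inner_sub_left, inner_sub_right, real_inner_smul_left, real_inner_self_eq_norm_sq,
    real_inner_comm x y]
  linarith

lemma eventually_norm_sq_le_mul_inner_of_radial {c : E → E} {K : ℝ} {x : E} (hI : IsOpen I)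
    (hI0 : ∀ ρ ∈ I, 0 < ρ) (hx : ‖x‖ ∈ I) (hw : ∀ y, HasGradientAt w (g y) y)
    (hg : MonotoneFieldOn g Set.univ) (hΦ : ∀ ρ ∈ I, HasDerivAt Φ (k ρ * ρ) ρ)
    (hk : ∀ ρ ∈ I, 0 ≤ k ρ) (hmono : MonotoneOn (fun ρ => k ρ * ρ) I)
    (hc : ∀ y, ‖y‖ ∈ I → c y = g y + k ‖y‖ • y) (hlip : ∀ y z, ‖c y - c z‖ ≤ K * ‖y - z‖) :
    ∀ᶠ z in 𝓝 x, ‖c z - c x‖ ^ 2 ≤ K * inner ℝ (c z - c x) (z - x) := by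
  refine eventually_norm_sq_le_mul_inner_of_gradient (φ := fun y => w y + Φ ‖y‖)
    ((hI.preimage continuous_norm).mem_nhds hx) (fun y hy => ?_) (fun y hy z hz => ?_)
    fun y _ z _ => hlip y z
  · rw [hc y hy]
    exact hasGradientAt_add (hw y)
      (hasGradientAt_comp_norm (norm_pos_iff.1 (hI0 _ hy)) (hΦ _ hy))
  · rw [hc y hy, hc z hz, add_sub_add_comm, inner_add_left]
    exact add_nonneg (hg y trivial z trivial) (monotoneFieldOn_radial hk hmono y hy z hz)

end Radial

section Annulus

omit [CompleteSpace E]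

/- Averaging the cutoff over the two points makes the part of the increment that is due to the
cutoff small: it is bounded by `R ‖y - z‖`, hence absorbed by the increment `R • (y - z)`. -/
lemma exists_tamedField_sub_eq (hgR : ∀ x, ‖x‖ < r → ‖g x‖ ≤ R) {y z : E}
    (hy : ‖y‖ ∈ Set.Ioo (r - 1) r) (hz : ‖z‖ ∈ Set.Ioo (r - 1) r) :
    ∃ q : E, ‖q‖ ≤ R * ‖y - z‖ ∧ tamedField g r R y - tamedField g r R z
      = (((r - ‖y‖) + (r - ‖z‖)) / 2) • (g y - g z) + (R • (y - z) + q) := by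
  refine ⟨(‖z‖ - ‖y‖) • (2⁻¹ : ℝ) • (g y + g z), ?_, ?_⟩
  · have hsum : ‖(2⁻¹ : ℝ) • (g y + g z)‖ ≤ R := by
      have := norm_add_le_of_le (hgR y hy.2) (hgR z hz.2)
      rw [norm_smul, Real.norm_of_nonneg (by norm_num)]
      linarith
    rw [norm_smul, norm_sub_rev y, mul_comm]
    exact mul_le_mul hsum (abs_norm_sub_norm_le z y) (norm_nonneg _) ((norm_nonneg _).trans hsum)
  · rw [tamedField_of_mem_annulus hy, tamedField_of_mem_annulus hz]
    module

lemma mul_norm_sub_le_of_mem_annulus (hgR : ∀ x, ‖x‖ < r → ‖g x‖ ≤ R) {K : NNReal}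
    (hlip : LipschitzWith K (tamedField g r R)) {y z : E}
    (hy : ‖y‖ ∈ Set.Ioo (r - 1) r) (hz : ‖z‖ ∈ Set.Ioo (r - 1) r) :
    ((r - ‖y‖) + (r - ‖z‖)) / 2 * ‖g y - g z‖ ≤ (K + 2 * R) * ‖y - z‖ := by
  obtain ⟨q, hq, hsub⟩ := exists_tamedField_sub_eq hgR hy hz
  have hR : 0 ≤ R := (norm_nonneg _).trans (hgR y hy.2)
  have hle := norm_sub_le_of_le (hlip.norm_sub_le y z)
    (norm_add_le_of_le (norm_smul R (y - z)).le hq)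
  rw [hsub, add_sub_cancel_right, norm_smul, Real.norm_of_nonneg hR,
    Real.norm_of_nonneg (by linarith [hy.2, hz.2])] at hle
  linarith

end Annulus

lemma eventually_norm_sq_le_mul_inner_annulus (hw : ∀ x, HasGradientAt w (g x) x)
    (hg : MonotoneFieldOn g Set.univ) (hgR : ∀ x, ‖x‖ < r → ‖g x‖ ≤ R) {K : NNReal} (hRK : R ≤ K)
    (hlip : LipschitzWith K (tamedField g r R)) {x : E} (hx : ‖x‖ ∈ Set.Ioo (r - 1) r) :
    ∀ᶠ z in 𝓝 x, ‖tamedField g r R z - tamedField g r R x‖ ^ 2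
      ≤ 2 * (K + 2 * R) * inner ℝ (tamedField g r R z - tamedField g r R x) (z - x) := by
  have hR : 0 ≤ R := (norm_nonneg _).trans (hgR x hx.2)
  have ht : 0 < r - ‖x‖ := sub_pos.2 hx.2
  set a := 6 / 7 * (r - ‖x‖) with ha_def
  have ha : 0 < a := by positivity
  set V : Set E := {y | ‖y‖ ∈ Set.Ioo (r - 1) r ∧ r - ‖y‖ ∈ Set.Ioo a (4 / 3 * a)}
  have hV : V ∈ 𝓝 x := by
    have hnorm := (continuous_norm (E := E)).tendsto x
    exact (hnorm.eventually_mem (Ioo_mem_nhds hx.1 hx.2)).and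
      ((hnorm.const_sub r).eventually_mem (Ioo_mem_nhds (by linarith) (by linarith)))
  have hglip : ∀ y ∈ V, ∀ z ∈ V, ‖g y - g z‖ ≤ (K + 2 * R) / a * ‖y - z‖ := fun y hy z hz => by
    rw [div_mul_eq_mul_div, le_div_iff₀ ha, mul_comm]
    exact (mul_le_mul_of_nonneg_right (by linarith [hy.2.1, hz.2.1]) (norm_nonneg _)).trans
      (mul_norm_sub_le_of_mem_annulus hgR hlip hy.1 hz.1)
  filter_upwards [hV, eventually_norm_sq_le_mul_inner_of_gradient hV (fun y _ => hw y)
    (fun y _ z _ => hg y trivial z trivial) hglip] with z hz hcoco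
  obtain ⟨q, hq, hsub⟩ := exists_tamedField_sub_eq hgR hz.1 hx
  set t := ((r - ‖z‖) + (r - ‖x‖)) / 2 with ht_def
  have ht0 : 0 ≤ t := by linarith [hz.2.1]
  have hta' : t ≤ 4 / 3 * a := by linarith [hz.2.2]
  have hta : t * ((K + 2 * R) / a) ≤ 4 / 3 * (K + 2 * R) := by
    rw [mul_div_assoc', div_le_iff₀ ha]
    nlinarith [K.coe_nonneg]
  have hgpart := norm_sq_le_mul_inner_of_le (by positivity) hta
    (norm_smul_sq_le_mul_inner ht0 hcoco)
  rw [hsub]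
  exact norm_sq_le_mul_inner_of_le (by positivity) (by linarith)
    (norm_add_sq_le_mul_inner (by positivity) (by positivity) hgpart
      (norm_smul_add_sq_le_mul_inner hR hq))

lemma eventually_norm_sq_le_mul_inner_of_lt (hw : ∀ x, HasGradientAt w (g x) x)
    (hg : MonotoneFieldOn g Set.univ) {K : NNReal} (hlip : LipschitzWith K (tamedField g r R))
    {x : E} (hx : ‖x‖ < r - 2) :
    ∀ᶠ z in 𝓝 x, ‖tamedField g r R z - tamedField g r R x‖ ^ 2
      ≤ K * inner ℝ (tamedField g r R z - tamedField g r R x) (z - x) := by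
  refine eventually_norm_sq_le_mul_inner_of_gradient (φ := w) (U := {y | ‖y‖ < r - 2})
    ((isOpen_lt continuous_norm continuous_const).mem_nhds hx) (fun y hy => ?_)
    (fun y hy z hz => ?_) fun y _ z _ => hlip.norm_sub_le y z
  · rw [tamedField_of_lt hy]
    exact hw y
  · rw [tamedField_of_lt hy, tamedField_of_lt hz]
    exact hg y trivial z trivial

lemma eventually_norm_sq_le_mul_inner_of_mem_Ioo (hw : ∀ x, HasGradientAt w (g x) x)
    (hg : MonotoneFieldOn g Set.univ) (hR : 0 ≤ R) {K : NNReal}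
    (hlip : LipschitzWith K (tamedField g r R)) {x : E} (hx0 : x ≠ 0)
    (hx : ‖x‖ ∈ Set.Ioo (r - 2) (r - 1)) :
    ∀ᶠ z in 𝓝 x, ‖tamedField g r R z - tamedField g r R x‖ ^ 2
      ≤ K * inner ℝ (tamedField g r R z - tamedField g r R x) (z - x) := by
  refine eventually_norm_sq_le_mul_inner_of_radial (I := Set.Ioo (r - 2) (r - 1) ∩ Set.Ioi 0)
    (Φ := fun ρ => R * (ρ ^ 3 / 3 - (r - 2) * (ρ ^ 2 / 2))) (k := fun ρ => R * (ρ - (r - 2)))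
    (isOpen_Ioo.inter isOpen_Ioi) (fun ρ hρ => hρ.2) ⟨hx, norm_pos_iff.2 hx0⟩ hw hg
    (fun ρ _ => ?_) (fun ρ hρ => mul_nonneg hR (sub_nonneg.2 hρ.1.1.le))
    (fun ρ hρ σ hσ hle => ?_) (fun y hy => tamedField_of_mem_Ioo hy.1) hlip.norm_sub_le
  · refine ((((hasDerivAt_pow 3 ρ).div_const 3).sub
      (((hasDerivAt_pow 2 ρ).div_const 2).const_mul (r - 2))).const_mul R).congr_deriv ?_
    ring
  · exact mul_le_mul (mul_le_mul_of_nonneg_left (by linarith) hR) hle hρ.2.le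
      (mul_nonneg hR (sub_nonneg.2 hσ.1.1.le))

lemma eventually_norm_sq_le_mul_inner_of_gt (hr : 0 < r) (hR : 0 ≤ R) {K : NNReal}
    (hlip : LipschitzWith K (tamedField g r R)) {x : E} (hx : r < ‖x‖) :
    ∀ᶠ z in 𝓝 x, ‖tamedField g r R z - tamedField g r R x‖ ^ 2
      ≤ K * inner ℝ (tamedField g r R z - tamedField g r R x) (z - x) := by
  have hcancel : ∀ ρ ∈ Set.Ioi r, R * (r / ρ) * ρ = R * r := fun ρ hρ => by
    rw [mul_assoc, div_mul_cancel₀ _ (hr.trans hρ).ne']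
  refine eventually_norm_sq_le_mul_inner_of_radial (I := Set.Ioi r) (w := 0) (g := 0)
    (Φ := fun ρ => R * r * ρ) (k := fun ρ => R * (r / ρ)) isOpen_Ioi (fun ρ hρ => hr.trans hρ) hx
    (fun y => hasGradientAt_const y 0) (fun y _ z _ => by simp) (fun ρ hρ => ?_)
    (fun ρ hρ => ?_) (fun ρ hρ σ hσ _ => ?_) (fun y hy => ?_) hlip.norm_sub_le
  · exact ((hasDerivAt_id ρ).const_mul (R * r)).congr_deriv
      ((mul_one _).trans (hcancel ρ hρ).symm)
  · exact mul_nonneg hR (div_pos hr (hr.trans hρ)).le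
  · exact (hcancel ρ hρ).le.trans (hcancel σ hσ).ge
  · rw [tamedField_of_gt hy, Pi.zero_apply, zero_add]

theorem cocoercive_tamedField [Nontrivial E] (hr : 0 < r) (hw : ∀ x, HasGradientAt w (g x) x)
    (hg : MonotoneFieldOn g Set.univ) (hgR : ∀ x, ‖x‖ < r → ‖g x‖ ≤ R) {K : NNReal}
    (hlip : LipschitzWith K (tamedField g r R)) :
    Cocoercive (tamedField g r R) (2 * (K + 2 * R)) := by
  have hR : 0 ≤ R := (norm_nonneg _).trans (hgR 0 (by simpa using hr))
  have hRK : R ≤ K :=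
    le_of_lipschitzWith_of_eq_smul_on_sphere hr hlip fun _ => tamedField_of_norm_eq
  have hK : (K : ℝ) ≤ 2 * (K + 2 * R) := by linarith [K.coe_nonneg]
  refine cocoercive_of_eventually_off_spheres hlip.continuous (by positivity)
    (ρs := {0, r - 2, r - 1, r}) (Set.toFinite _) fun x hx => ?_
  simp only [Set.mem_insert_iff, Set.mem_singleton_iff, not_or] at hx
  obtain ⟨hx0, hx2, hx1, hxr⟩ := hx
  rcases lt_or_gt_of_ne hx2 with hlt2 | hgt2
  · filter_upwards [eventually_norm_sq_le_mul_inner_of_lt hw hg hlip hlt2] with z hz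
    exact norm_sq_le_mul_inner_of_le K.coe_nonneg hK hz
  rcases lt_or_gt_of_ne hx1 with hlt1 | hgt1
  · filter_upwards [eventually_norm_sq_le_mul_inner_of_mem_Ioo hw hg hR hlip
      (norm_ne_zero_iff.1 hx0) ⟨hgt2, hlt1⟩] with z hz
    exact norm_sq_le_mul_inner_of_le K.coe_nonneg hK hz
  rcases lt_or_gt_of_ne hxr with hltr | hgtr
  · exact eventually_norm_sq_le_mul_inner_annulus hw hg hgR hRK hlip ⟨hgt1, hltr⟩
  · filter_upwards [eventually_norm_sq_le_mul_inner_of_gt hr hR hlip hgtr] with z hz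
    exact norm_sq_le_mul_inner_of_le K.coe_nonneg hK hz

end Cocoercivity

/-! ### The tamed drift -/

section TamedFieldAddSMul

variable {E : Type*} [NormedAddCommGroup E] [InnerProductSpace ℝ E] [CompleteSpace E] [Nontrivial E]
  {g : E → E} {w : E → ℝ} {r R m : ℝ} {M : NNReal}

omit [CompleteSpace E] in
lemma add_le_of_lipschitzWith_tamedField_add_smul (hr : 0 < r)
    (hlip : LipschitzWith M fun x => tamedField g r R x + m • x) : R + m ≤ M :=
  le_of_lipschitzWith_of_eq_smul_on_sphere hr hlip fun x hx => by
    rw [tamedField_of_norm_eq hx, add_smul]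

lemma cocoercive_tamedField_of_add_smul (hr : 0 < r) (hw : ∀ x, HasGradientAt w (g x) x)
    (hg : MonotoneFieldOn g Set.univ) (hgR : ∀ x, ‖x‖ < r → ‖g x‖ ≤ R) (hm : 0 ≤ m)
    (hlip : LipschitzWith M fun x => tamedField g r R x + m • x) :
    Cocoercive (tamedField g r R) (6 * M - m) := by
  lift m to NNReal using hm
  have hR : 0 ≤ R := (norm_nonneg _).trans (hgR 0 (by simpa using hr))
  have hRm := add_le_of_lipschitzWith_tamedField_add_smul hr hlip
  have hfield : LipschitzWith (M + m) (tamedField g r R) := by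
    simpa using hlip.sub (lipschitzWith_smul (m : ℝ))
  refine (cocoercive_tamedField hr hw hg hgR hfield).mono (by positivity) ?_
  rw [NNReal.coe_add]
  linarith [m.coe_nonneg]

end TamedFieldAddSMul

section TamedDrift

variable {d : ℕ} {h : EuclideanSpace ℝ (Fin d) → EuclideanSpace ℝ (Fin d)}
  {u : EuclideanSpace ℝ (Fin d) → ℝ} {m L l lam r : ℝ}

lemma tameRadius_pos (hm : 0 < m) (hL : 0 < L) (hlam : 0 < lam) : 0 < tameRadius m L l lam :=
  mul_pos (add_pos hL hm) (Real.rpow_pos_of_pos (by positivity) _)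

lemma lipschitzWith_lipConst {f : EuclideanSpace ℝ (Fin d) → EuclideanSpace ℝ (Fin d)}
    (hf : ∃ K : NNReal, LipschitzWith K f) : LipschitzWith (lipConst f) f := by
  have hclosed : IsClosed {K : NNReal | LipschitzWith K f} := by
    simp only [lipschitzWith_iff_dist_le_mul, Set.ofPred_forall]
    exact isClosed_iInter fun x => isClosed_iInter fun y => isClosed_le (by fun_prop) (by fun_prop)
  exact hclosed.csInf_mem hf (OrderBot.bddBelow _)

lemma exists_lipschitzOnWith_shifted (hL : 0 ≤ L) (hl : 0 ≤ l) (hpoly : PolyLipschitz h L l)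
    (m : ℝ) (hr : 0 ≤ r) : ∃ G, LipschitzOnWith G (shifted h m) (Metric.closedBall 0 r) := by
  have hh : LipschitzOnWith (L * (1 + r + r) ^ l).toNNReal h (Metric.closedBall 0 r) := by
    refine LipschitzOnWith.of_dist_le_mul fun x hx y hy => ?_
    rw [mem_closedBall_zero_iff] at hx hy
    rw [Real.coe_toNNReal _ (by positivity), dist_eq_norm, dist_eq_norm]
    refine (hpoly x y).trans ?_
    gcongr
  exact ⟨_, hh.sub (lipschitzWith_smul m).lipschitzOnWith⟩

lemma norm_shifted_le_supBall {G : NNReal}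
    (hG : LipschitzOnWith G (shifted h m) (Metric.closedBall 0 r)) {x : EuclideanSpace ℝ (Fin d)}
    (hx : ‖x‖ < r) : ‖shifted h m x‖ ≤ supBall (shifted h m) r := by
  have hbdd : BddAbove ((fun x => ‖shifted h m x‖) '' Metric.ball 0 r) :=
    ((isCompact_closedBall _ _).bddAbove_image hG.continuousOn.norm).mono
      (Set.image_mono Metric.ball_subset_closedBall)
  exact le_csSup hbdd ⟨x, mem_ball_zero_iff.2 hx, rfl⟩

lemma supBall_nonneg (g : EuclideanSpace ℝ (Fin d) → EuclideanSpace ℝ (Fin d)) (r : ℝ) :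
    0 ≤ supBall g r := by
  refine Real.sSup_nonneg ?_
  rintro _ ⟨x, -, rfl⟩
  exact norm_nonneg _

lemma monotoneFieldOn_shifted (hm : 0 ≤ m) (hh : StronglyMonotone h m) :
    MonotoneFieldOn (shifted h m) Set.univ := fun x _ y _ => by
  rw [shifted, shifted, sub_sub_sub_comm, ← smul_sub, inner_sub_left, real_inner_smul_left,
    real_inner_self_eq_norm_sq]
  linarith [hh x y, mul_nonneg hm (sq_nonneg ‖x - y‖)]

lemma hasGradientAt_shifted (hu : Differentiable ℝ u) (m : ℝ) (x : EuclideanSpace ℝ (Fin d)) :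
    HasGradientAt (fun y => u y - m / 2 * ‖y‖ ^ 2) (shifted (gradient u) m x) x :=
  hasGradientAt_sub (hu x).hasGradientAt (hasGradientAt_half_mul_norm_sq m x)

lemma lipschitzWith_tamedDrift (hm : 0 < m) (hL : 0 < L) (hl : 0 ≤ l) (hlam : 0 < lam)
    (hpoly : PolyLipschitz h L l) :
    LipschitzWith (lipConst (tamedDrift h m L l lam)) (tamedDrift h m L l lam) := by
  have hr : 0 < tameRadius m L l lam := tameRadius_pos hm hL hlam
  obtain ⟨G, hG⟩ := exists_lipschitzOnWith_shifted hL.le hl hpoly m hr.le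
  obtain ⟨K, hK⟩ := exists_lipschitzWith_tamedField hr.le hG
    (supBall (shifted h m) (tameRadius m L l lam))
  exact lipschitzWith_lipConst ⟨_, hK.add (lipschitzWith_smul m)⟩

variable [Nonempty (Fin d)]

lemma le_lipConst_tamedDrift (hm : 0 < m) (hL : 0 < L) (hl : 0 ≤ l)
    (hlam : 0 < lam) (hpoly : PolyLipschitz h L l) : m ≤ lipConst (tamedDrift h m L l lam) :=
  (le_add_of_nonneg_left (supBall_nonneg _ _)).trans <|
    add_le_of_lipschitzWith_tamedField_add_smul (tameRadius_pos hm hL hlam)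
      (lipschitzWith_tamedDrift hm hL hl hlam hpoly)

lemma cocoercive_tamedField_shifted (hu : Differentiable ℝ u) (hm : 0 < m) (hL : 0 < L)
    (hl : 0 ≤ l) (hlam : 0 < lam) (hmono : StronglyMonotone (gradient u) m)
    (hpoly : PolyLipschitz (gradient u) L l) :
    Cocoercive (tamedField (shifted (gradient u) m) (tameRadius m L l lam)
        (supBall (shifted (gradient u) m) (tameRadius m L l lam)))
      (6 * lipConst (tamedDrift (gradient u) m L l lam) - m) := by
  have hr : 0 < tameRadius m L l lam := tameRadius_pos hm hL hlam
  obtain ⟨G, hG⟩ := exists_lipschitzOnWith_shifted hL.le hl hpoly m hr.le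
  exact cocoercive_tamedField_of_add_smul hr (hasGradientAt_shifted hu m)
    (monotoneFieldOn_shifted hm.le hmono) (fun x => norm_shifted_le_supBall hG) hm.le
    (lipschitzWith_tamedDrift hm hL hl hlam hpoly)

theorem cocoercive_tamedDrift (hu : Differentiable ℝ u) (hm : 0 < m) (hL : 0 < L) (hl : 0 ≤ l)
    (hlam : 0 < lam) (hmono : StronglyMonotone (gradient u) m)
    (hpoly : PolyLipschitz (gradient u) L l) :
    Cocoercive (tamedDrift (gradient u) m L l lam)
      (6 * lipConst (tamedDrift (gradient u) m L l lam)) := by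
  have hle := le_lipConst_tamedDrift hm hL hl hlam hpoly
  have hadd := (cocoercive_tamedField_shifted hu hm hL hl hlam hmono hpoly).add
    (cocoercive_const_smul m) (by linarith) hm.le
  rwa [sub_add_cancel] at hadd

theorem stronglyMonotone_tamedDrift (hu : Differentiable ℝ u) (hm : 0 < m) (hL : 0 < L)
    (hl : 0 ≤ l) (hlam : 0 < lam) (hmono : StronglyMonotone (gradient u) m)
    (hpoly : PolyLipschitz (gradient u) L l) :
    StronglyMonotone (tamedDrift (gradient u) m L l lam) (m / 2) := fun x y => by
  have hle := le_lipConst_tamedDrift hm hL hl hlam hpoly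
  have hfield := (cocoercive_tamedField_shifted hu hm hL hl hlam hmono hpoly).monotoneFieldOn_univ
    (by linarith) x trivial y trivial
  have hsub : tamedDrift (gradient u) m L l lam x - tamedDrift (gradient u) m L l lam y
      = (tamedField (shifted (gradient u) m) (tameRadius m L l lam)
            (supBall (shifted (gradient u) m) (tameRadius m L l lam)) x
          - tamedField (shifted (gradient u) m) (tameRadius m L l lam)
            (supBall (shifted (gradient u) m) (tameRadius m L l lam)) y) + m • (x - y) := by
    rw [smul_sub, ← add_sub_add_comm]
    rfl
  rw [hsub, inner_add_left, real_inner_smul_left, real_inner_self_eq_norm_sq]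
  linarith

end TamedDrift

/-! ### One step of the scheme as a contraction plus noise -/

section Contraction

variable {E : Type*} [NormedAddCommGroup E] [InnerProductSpace ℝ E]

lemma norm_sq_relax_add_norm_sq_relax (a c q : E) (p η : ℝ) :
    ‖a + p • (c - a) - (η - 2 * p) • q‖ ^ 2 + ‖c - p • (c - a) - (η + 2 * p) • q‖ ^ 2
      = ‖a‖ ^ 2 + ‖c‖ ^ 2 - 2 * p * (1 - p) * ‖c - a‖ ^ 2 + (2 * η ^ 2 + 8 * p ^ 2) * ‖q‖ ^ 2
        - 4 * η * inner ℝ q a - 2 * (η + 2 * p - 4 * p ^ 2) * inner ℝ (c - a) q := by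
  obtain ⟨w, rfl⟩ : ∃ w, c = a + w := ⟨c - a, (add_sub_cancel a c).symm⟩
  have hfst : a + p • (a + w - a) - (η - 2 * p) • q = a + p • w - (η - 2 * p) • q := by module
  have hsnd : a + w - p • (a + w - a) - (η + 2 * p) • q
      = a + (1 - p) • w - (η + 2 * p) • q := by module
  have hexpand (s t : ℝ) : ‖a + s • w - t • q‖ ^ 2 = ‖a‖ ^ 2 + s ^ 2 * ‖w‖ ^ 2 + t ^ 2 * ‖q‖ ^ 2
      + 2 * s * inner ℝ a w - 2 * t * inner ℝ q a - 2 * s * t * inner ℝ w q := by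
    rw [norm_sub_sq_real, norm_add_sq_real, inner_add_left, norm_smul, norm_smul,
      real_inner_smul_right, real_inner_smul_right, real_inner_smul_right, real_inner_smul_left,
      mul_pow, mul_pow, Real.norm_eq_abs, Real.norm_eq_abs, sq_abs, sq_abs, real_inner_comm q a]
    ring
  rw [hfst, hsnd, hexpand, hexpand, norm_add_sq_real a w, add_sub_cancel_left]
  ring

lemma norm_sq_relax_add_norm_sq_relax_le {a c q : E} {p η κ : ℝ} (hη : 0 ≤ η) (hη' : η ≤ 1 / 2)
    (hp : η / 3 ≤ p) (hp' : p ≤ η / 2) (hκ : 0 ≤ κ) (hκ' : κ ≤ 1 / 25)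
    (hmono : κ * ‖a‖ ^ 2 ≤ inner ℝ q a) (hcoco : 25 * ‖q‖ ^ 2 ≤ 6 * inner ℝ q a) :
    ‖a + p • (c - a) - (η - 2 * p) • q‖ ^ 2 + ‖c - p • (c - a) - (η + 2 * p) • q‖ ^ 2
      ≤ (1 - η * κ / 5) * (‖a‖ ^ 2 + ‖c‖ ^ 2) := by
  have hcross : -inner ℝ (c - a) q ≤ ‖c - a‖ ^ 2 / 10 + 5 / 2 * ‖q‖ ^ 2 := by
    nlinarith [sq_nonneg (‖c - a‖ - 5 * ‖q‖), (abs_le.1 (abs_real_inner_le_norm (c - a) q)).1]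
  have hcross' : -(2 * (η + 2 * p - 4 * p ^ 2) * inner ℝ (c - a) q)
      ≤ 4 * η * (‖c - a‖ ^ 2 / 10 + 5 / 2 * ‖q‖ ^ 2) := by
    have h1 := mul_le_mul_of_nonneg_left hcross (show 0 ≤ η + 2 * p - 4 * p ^ 2 by nlinarith)
    have h2 := mul_le_mul_of_nonneg_right (show η + 2 * p - 4 * p ^ 2 ≤ 2 * η by nlinarith)
      (show 0 ≤ ‖c - a‖ ^ 2 / 10 + 5 / 2 * ‖q‖ ^ 2 by positivity)
    linarith
  have hrelax : η / 2 * ‖c - a‖ ^ 2 ≤ 2 * p * (1 - p) * ‖c - a‖ ^ 2 :=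
    mul_le_mul_of_nonneg_right (by nlinarith) (sq_nonneg _)
  have hquad : (2 * η ^ 2 + 8 * p ^ 2) * ‖q‖ ^ 2 ≤ 2 * η * ‖q‖ ^ 2 :=
    mul_le_mul_of_nonneg_right (by nlinarith) (sq_nonneg _)
  have hforce : 12 * (η * ‖q‖ ^ 2) + η * κ * ‖a‖ ^ 2 ≤ 4 * η * inner ℝ q a := by
    nlinarith [mul_le_mul_of_nonneg_left hcoco hη, mul_le_mul_of_nonneg_left hmono hη]
  have hc : ‖c‖ ^ 2 ≤ 2 * ‖a‖ ^ 2 + 2 * ‖c - a‖ ^ 2 := by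
    have := norm_le_norm_add_norm_sub' c a
    nlinarith [sq_nonneg (‖a‖ - ‖c - a‖), norm_nonneg c]
  have hc' := mul_le_mul_of_nonneg_left hc (show 0 ≤ η * κ / 5 by positivity)
  have hκw : η * κ * ‖c - a‖ ^ 2 ≤ η * (1 / 25) * ‖c - a‖ ^ 2 := by gcongr
  rw [norm_sq_relax_add_norm_sq_relax]
  nlinarith [show 0 ≤ η * κ * ‖a‖ ^ 2 by positivity, show 0 ≤ η * ‖c - a‖ ^ 2 by positivity]

lemma psi1_le {γ lam : ℝ} (hγ : 0 < γ) : psi1 γ lam ≤ lam := by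
  rw [psi1, div_le_iff₀ hγ]
  linarith [Real.add_one_le_exp (-γ * lam)]

lemma le_mul_psi1 {γ lam : ℝ} (hγ : 0 < γ) (hlam : 0 < lam) (hlam' : lam * γ ≤ 1 / 2) :
    lam * γ / 3 ≤ γ / 2 * psi1 γ lam := by
  have hη := mul_pos hlam hγ
  have hexp : Real.exp (-γ * lam) ≤ (1 + lam * γ)⁻¹ := by
    rw [show -γ * lam = -(lam * γ) by ring, Real.exp_neg]
    exact inv_anti₀ (by linarith) (by linarith [Real.add_one_le_exp (lam * γ)])
  have hinv : (1 + lam * γ)⁻¹ ≤ 1 - 2 / 3 * (lam * γ) := by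
    rw [inv_le_iff_one_le_mul₀ (by linarith)]
    nlinarith
  rw [psi1, div_mul_div_cancel₀' hγ.ne']
  linarith

/-- The deterministic part of one step of the scheme with drift `b`, in the coordinates
`(x, x + (2/γ) v)`. -/
noncomputable def stepMap (b : E → E) (γ lam : ℝ) (z : WithLp 2 (E × E)) : WithLp 2 (E × E) :=
  WithLp.toLp 2
    (z.fst + (γ / 2 * psi1 γ lam) • (z.snd - z.fst) - psi2 γ lam • b z.fst,
      z.snd - (γ / 2 * psi1 γ lam) • (z.snd - z.fst) - (psi2 γ lam + 2 / γ * psi1 γ lam) • b z.fst)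

lemma norm_stepMap_sub_sq (b : E → E) {γ : ℝ} (hγ : γ ≠ 0) (lam : ℝ) (z z' : WithLp 2 (E × E)) :
    let p := γ / 2 * psi1 γ lam
    let a := z.fst - z'.fst
    let c := z.snd - z'.snd
    let q := (γ ^ 2)⁻¹ • (b z.fst - b z'.fst)
    ‖stepMap b γ lam z - stepMap b γ lam z'‖ ^ 2
      = ‖a + p • (c - a) - (lam * γ - 2 * p) • q‖ ^ 2
        + ‖c - p • (c - a) - (lam * γ + 2 * p) • q‖ ^ 2 := by
  intro p a c q
  have hψ : psi2 γ lam = (lam * γ - 2 * p) * (γ ^ 2)⁻¹ := by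
    simp only [p, psi1, psi2]
    field_simp
    ring
  have hψ' : psi2 γ lam + 2 / γ * psi1 γ lam = (lam * γ + 2 * p) * (γ ^ 2)⁻¹ := by
    rw [hψ]
    simp only [p]
    field_simp
    ring
  rw [WithLp.prod_norm_sq_eq_of_L2, WithLp.sub_fst, WithLp.sub_snd]
  congr 3
  · simp only [stepMap, hψ, q, a, c, WithLp.toLp_fst]
    module
  · simp only [stepMap, hψ', q, a, c, WithLp.toLp_snd]
    module

lemma one_sub_mul_div_mem_Icc {m γ lam : ℝ} (hm : 0 ≤ m) (hγ : 0 < γ) (hγm : 25 * m ≤ γ ^ 2)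
    (hlam : 0 < lam) (hlam' : lam * γ ≤ 1 / 2) : 1 - m * lam / (5 * γ) ∈ Set.Icc 0 1 := by
  have hle : m * lam ≤ 5 * γ := by nlinarith
  exact ⟨sub_nonneg.2 (div_le_one_of_le₀ hle (by positivity)), sub_le_self _ (by positivity)⟩

lemma lipschitzWith_stepMap {b : E → E} {m M γ lam : ℝ} (hm : 0 ≤ m) (hmM : m ≤ M)
    (hmono : ∀ x y, m * ‖x - y‖ ^ 2 ≤ inner ℝ (b x - b y) (x - y)) (hcoco : Cocoercive b (6 * M))
    (hγ : 0 < γ) (hγM : 25 * M ≤ γ ^ 2) (hlam : 0 < lam) (hlam' : lam * γ ≤ 1 / 2) :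
    LipschitzWith (√(1 - m * lam / (5 * γ))).toNNReal (stepMap b γ lam) := by
  have hη : 0 < lam * γ := mul_pos hlam hγ
  have hκ : m / γ ^ 2 ≤ 1 / 25 := by
    rw [div_le_div_iff₀ (by positivity) (by norm_num)]
    linarith
  have hρ : 1 - m * lam / (5 * γ) = 1 - lam * γ * (m / γ ^ 2) / 5 := by field_simp
  have hρ₀ := (one_sub_mul_div_mem_Icc hm hγ (by linarith) hlam hlam').1
  refine LipschitzWith.of_dist_le_mul fun z z' => ?_
  rw [Real.coe_toNNReal _ (Real.sqrt_nonneg _), dist_eq_norm, dist_eq_norm]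
  refine le_of_sq_le_sq ?_ (by positivity)
  rw [mul_pow, Real.sq_sqrt hρ₀, hρ, WithLp.prod_norm_sq_eq_of_L2 (z - z'),
    norm_stepMap_sub_sq b hγ.ne' lam z z']
  refine norm_sq_relax_add_norm_sq_relax_le hη.le hlam' (le_mul_psi1 hγ hlam hlam') ?_
    (by positivity) hκ ?_ ?_
  · nlinarith [psi1_le (lam := lam) hγ]
  · rw [real_inner_smul_left, div_mul_eq_mul_div, div_eq_inv_mul]
    exact mul_le_mul_of_nonneg_left (hmono _ _) (by positivity)
  · have hcoco' := hcoco z.fst z'.fst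
    have hinner := (mul_nonneg hm (sq_nonneg _)).trans (hmono z.fst z'.fst)
    rw [norm_smul, real_inner_smul_left, mul_pow, Real.norm_of_nonneg (by positivity)]
    calc 25 * (((γ ^ 2)⁻¹) ^ 2 * ‖b z.fst - b z'.fst‖ ^ 2)
        = ((γ ^ 2)⁻¹) ^ 2 * (25 * ‖b z.fst - b z'.fst‖ ^ 2) := by ring
      _ ≤ ((γ ^ 2)⁻¹) ^ 2 * (6 * γ ^ 2 * inner ℝ (b z.fst - b z'.fst) (z.fst - z'.fst)) :=
        mul_le_mul_of_nonneg_left (by nlinarith) (by positivity)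
      _ = 6 * ((γ ^ 2)⁻¹ * inner ℝ (b z.fst - b z'.fst) (z.fst - z'.fst)) := by field_simp

/-- The noise of one step of the scheme, in the coordinates `(x, x + (2/γ) v)`. -/
noncomputable def stepNoise (γ : ℝ) (ξ ξ' : E) : WithLp 2 (E × E) :=
  WithLp.toLp 2 (√(2 * γ) • ξ', √(2 * γ) • ξ' + (√(2 * γ) * (2 / γ)) • ξ)

end Contraction

lemma coordM_expScheme_succ {d : ℕ} {Ω : Type*}
    (b : EuclideanSpace ℝ (Fin d) → EuclideanSpace ℝ (Fin d)) {γ : ℝ} (hγ : γ ≠ 0) (lam : ℝ)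
    (θ₀ V₀ : Ω → EuclideanSpace ℝ (Fin d)) (Ξ Ξ' : ℕ → Ω → EuclideanSpace ℝ (Fin d)) (n : ℕ)
    (ω : Ω) :
    coordM γ (expScheme b γ lam θ₀ V₀ Ξ Ξ' (n + 1) ω)
      = stepMap b γ lam (coordM γ (expScheme b γ lam θ₀ V₀ Ξ Ξ' n ω))
        + stepNoise γ (Ξ n ω) (Ξ' n ω) := by
  have hψ₀ : psi0 γ lam = 1 - γ * psi1 γ lam := by
    rw [psi0, psi1]
    field_simp
    ring
  refine WithLp.ofLp_injective 2 (Prod.ext ?_ ?_) <;>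
    simp only [expScheme, coordM, stepMap, stepNoise, hψ₀, WithLp.ofLp_add, Prod.fst_add,
      Prod.snd_add, WithLp.toLp_fst, WithLp.toLp_snd] <;>
    match_scalars <;> field_simp <;> ring

/-! ### The Gaussian noise of one step -/

section Noise

lemma variance_inner_of_hasLaw_multivariateGaussian {Ω ι : Type*} [MeasurableSpace Ω]
    {P : Measure Ω} [Fintype ι] [DecidableEq ι] {S : Matrix ι ι ℝ} (hS : S.PosSemidef)
    {μ : EuclideanSpace ℝ ι} {X : Ω → EuclideanSpace ℝ ι}
    (hX : HasLaw X (multivariateGaussian μ S) P) (w : EuclideanSpace ℝ ι) :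
    Var[fun ω => inner ℝ w (X ω); P] = w ⬝ᵥ S.mulVec w := by
  rw [← covarianceBilin_multivariateGaussian hS (μ := μ),
    covarianceBilin_self IsGaussian.memLp_two_id, ← hX.map_eq,
    variance_map (by fun_prop) hX.aemeasurable]
  rfl

lemma continuous_psi0 (γ : ℝ) : Continuous (psi0 γ) := by
  unfold psi0
  fun_prop

lemma continuous_psi1 (γ : ℝ) : Continuous (psi1 γ) := by
  unfold psi1
  exact Continuous.div_const (by fun_prop) γ

lemma dotProduct_noiseCov_mulVec (γ lam : ℝ) (w : Fin 2 → ℝ) :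
    w ⬝ᵥ (noiseCov γ lam).mulVec w
      = ∫ t in (0 : ℝ)..lam, (psi0 γ t * w 0 + psi1 γ t * w 1) ^ 2 := by
  have h0 := continuous_psi0 γ
  have h1 := continuous_psi1 γ
  have h00 : IntervalIntegrable (fun t => psi0 γ t * psi0 γ t) volume 0 lam :=
    (h0.mul h0).intervalIntegrable _ _
  have h01 : IntervalIntegrable (fun t => psi0 γ t * psi1 γ t) volume 0 lam :=
    (h0.mul h1).intervalIntegrable _ _
  have h11 : IntervalIntegrable (fun t => psi1 γ t * psi1 γ t) volume 0 lam :=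
    (h1.mul h1).intervalIntegrable _ _
  have hexpand (t : ℝ) : (psi0 γ t * w 0 + psi1 γ t * w 1) ^ 2 = psi0 γ t * psi0 γ t * w 0 ^ 2
      + psi0 γ t * psi1 γ t * (2 * (w 0 * w 1)) + psi1 γ t * psi1 γ t * w 1 ^ 2 := by ring
  simp only [hexpand]
  rw [intervalIntegral.integral_add ((h00.mul_const _).add (h01.mul_const _)) (h11.mul_const _),
    intervalIntegral.integral_add (h00.mul_const _) (h01.mul_const _)]
  simp only [intervalIntegral.integral_mul_const, noiseCov, Matrix.mulVec, dotProduct,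
    Fin.sum_univ_two, Matrix.of_apply, Matrix.cons_val_one, Matrix.cons_val_zero,
    mul_comm (psi1 γ _) (psi0 γ _)]
  ring

lemma posSemidef_noiseCov {γ lam : ℝ} (hlam : 0 ≤ lam) : (noiseCov γ lam).PosSemidef := by
  refine Matrix.PosSemidef.of_dotProduct_mulVec_nonneg ?_ fun w => ?_
  · ext i j
    fin_cases i <;> fin_cases j <;> simp [noiseCov, mul_comm]
  · rw [star_trivial, dotProduct_noiseCov_mulVec]
    exact intervalIntegral.integral_nonneg hlam fun t _ => sq_nonneg _

lemma dotProduct_noiseCov_mulVec_le {γ lam : ℝ} (hγ : 0 < γ) (hlam : 0 ≤ lam) (w : Fin 2 → ℝ) :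
    w ⬝ᵥ (noiseCov γ lam).mulVec w ≤ 2 * lam * (w 0 ^ 2 + lam ^ 2 * w 1 ^ 2) := by
  have h0 := continuous_psi0 γ
  have h1 := continuous_psi1 γ
  rw [dotProduct_noiseCov_mulVec]
  calc ∫ t in (0 : ℝ)..lam, (psi0 γ t * w 0 + psi1 γ t * w 1) ^ 2
      ≤ ∫ _ in (0 : ℝ)..lam, 2 * (w 0 ^ 2 + lam ^ 2 * w 1 ^ 2) := by
        refine intervalIntegral.integral_mono_on hlam
          (Continuous.intervalIntegrable (by fun_prop) _ _) (by simp) fun t ht => ?_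
        have hexp : Real.exp (-γ * t) ≤ 1 := Real.exp_le_one_iff.2 (by nlinarith [ht.1])
        have hψ₀ : psi0 γ t ^ 2 ≤ 1 := pow_le_one₀ (Real.exp_pos _).le hexp
        have hψ₁ : psi1 γ t ^ 2 ≤ lam ^ 2 :=
          pow_le_pow_left₀ (div_nonneg (by linarith) hγ.le) ((psi1_le hγ).trans ht.2) 2
        nlinarith [sq_nonneg (psi0 γ t * w 0 - psi1 γ t * w 1),
          mul_le_mul_of_nonneg_right hψ₀ (sq_nonneg (w 0)),
          mul_le_mul_of_nonneg_right hψ₁ (sq_nonneg (w 1))]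
    _ = 2 * lam * (w 0 ^ 2 + lam ^ 2 * w 1 ^ 2) := by
        rw [intervalIntegral.integral_const, smul_eq_mul]
        ring

/-- The weights with which the `i`-th coordinates of the two noise vectors enter the inner product
of `ζ` with `stepNoise`. -/
noncomputable def noiseWeight {d : ℕ} (γ : ℝ)
    (ζ : WithLp 2 (EuclideanSpace ℝ (Fin d) × EuclideanSpace ℝ (Fin d))) (i : Fin d) :
    EuclideanSpace ℝ (Fin 2) :=
  !₂[√(2 * γ) * (2 / γ) * ζ.snd i, √(2 * γ) * (ζ.fst i + ζ.snd i)]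

variable {d : ℕ}

lemma inner_stepNoise (γ : ℝ)
    (ζ : WithLp 2 (EuclideanSpace ℝ (Fin d) × EuclideanSpace ℝ (Fin d)))
    (ξ ξ' : EuclideanSpace ℝ (Fin d)) :
    inner ℝ ζ (stepNoise γ ξ ξ') = ∑ i, inner ℝ (noiseWeight γ ζ i) !₂[ξ i, ξ' i] := by
  simp only [stepNoise, noiseWeight, WithLp.prod_inner_apply, PiLp.inner_apply, Fin.sum_univ_two,
    ← Finset.sum_add_distrib]
  refine Finset.sum_congr rfl fun i _ => ?_
  simp
  ring

lemma dotProduct_noiseWeight_le {γ lam : ℝ} (hγ : 0 < γ) (hlam : 0 < lam)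
    (hlam' : lam * γ ≤ 1 / 2)
    (ζ : WithLp 2 (EuclideanSpace ℝ (Fin d) × EuclideanSpace ℝ (Fin d))) (i : Fin d) :
    noiseWeight γ ζ i ⬝ᵥ (noiseCov γ lam).mulVec (noiseWeight γ ζ i)
      ≤ 18 * (lam / γ) * (ζ.fst i ^ 2 + ζ.snd i ^ 2) := by
  refine (dotProduct_noiseCov_mulVec_le hγ hlam.le _).trans ?_
  simp only [noiseWeight, PiLp.toLp_apply, Matrix.cons_val_zero, Matrix.cons_val_one, mul_pow,
    Real.sq_sqrt (show 0 ≤ 2 * γ by positivity)]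
  generalize ζ.fst i = x
  generalize ζ.snd i = y
  have hη : (lam * γ) ^ 2 ≤ 1 / 4 := by nlinarith [mul_pos hlam hγ]
  have hxy : 2 * ((lam * γ) ^ 2 * (x + y) ^ 2) ≤ x ^ 2 + y ^ 2 := by
    nlinarith [sq_nonneg (x - y), mul_le_mul_of_nonneg_right hη (sq_nonneg (x + y))]
  calc 2 * lam * (2 * γ * (2 / γ) ^ 2 * y ^ 2 + lam ^ 2 * (2 * γ * (x + y) ^ 2))
      = 2 * (lam / γ) * (8 * y ^ 2 + 2 * ((lam * γ) ^ 2 * (x + y) ^ 2)) := by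
        field_simp
        ring
    _ ≤ 2 * (lam / γ) * (9 * (x ^ 2 + y ^ 2)) :=
        mul_le_mul_of_nonneg_left (by nlinarith [sq_nonneg x]) (by positivity)
    _ = 18 * (lam / γ) * (x ^ 2 + y ^ 2) := by ring

variable {Ω : Type*} [MeasurableSpace Ω] {P : Measure Ω} {γ lam : ℝ}
  {θ₀ V₀ : Ω → EuclideanSpace ℝ (Fin d)} {Ξ Ξ' : ℕ → Ω → EuclideanSpace ℝ (Fin d)}

lemma iIndepFun_noisePair (hin : IsSchemeInput P γ lam θ₀ V₀ Ξ Ξ') (n : ℕ) :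
    iIndepFun (fun (i : Fin d) ω => !₂[Ξ n ω i, Ξ' n ω i]) P :=
  (hin.indep_coords n).comp (fun _ p => !₂[p.1, p.2]) fun _ => by fun_prop

lemma hasGaussianLaw_stepNoise (hin : IsSchemeInput P γ lam θ₀ V₀ Ξ Ξ') (n : ℕ) :
    HasGaussianLaw (fun ω => stepNoise γ (Ξ n ω) (Ξ' n ω)) P := by
  have hW : HasGaussianLaw (fun ω i => !₂[Ξ n ω i, Ξ' n ω i]) P :=
    (iIndepFun_noisePair hin n).hasGaussianLaw fun i => (hin.law_coords n i).hasGaussianLaw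
  let A (j : Fin 2) : (Fin d → EuclideanSpace ℝ (Fin 2)) →L[ℝ] EuclideanSpace ℝ (Fin d) :=
    (EuclideanSpace.equiv (Fin d) ℝ).symm.toContinuousLinearMap ∘L
      ContinuousLinearMap.pi fun i => EuclideanSpace.proj j ∘L ContinuousLinearMap.proj i
  exact (hW.map_fun ((√(2 * γ) • A 1).prod
    (√(2 * γ) • A 1 + (√(2 * γ) * (2 / γ)) • A 0))).toLp_prodMk 2

lemma variance_inner_stepNoise_le [IsProbabilityMeasure P] (hγ : 0 < γ) (hlam : 0 < lam)
    (hlam' : lam * γ ≤ 1 / 2) (hin : IsSchemeInput P γ lam θ₀ V₀ Ξ Ξ') (n : ℕ)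
    (ζ : WithLp 2 (EuclideanSpace ℝ (Fin d) × EuclideanSpace ℝ (Fin d))) :
    Var[fun ω => inner ℝ ζ (stepNoise γ (Ξ n ω) (Ξ' n ω)); P] ≤ 18 * (lam / γ) * ‖ζ‖ ^ 2 := by
  let X (i : Fin d) (ω : Ω) : ℝ := inner ℝ (noiseWeight γ ζ i) !₂[Ξ n ω i, Ξ' n ω i]
  have hL2 (i : Fin d) : MemLp (X i) 2 P :=
    ((hin.law_coords n i).hasGaussianLaw.map_fun (innerSL ℝ (noiseWeight γ ζ i))).memLp_two
  have hindep : iIndepFun X P := (iIndepFun_noisePair hin n).comp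
    (fun i w => inner ℝ (noiseWeight γ ζ i) w) fun i => by fun_prop
  calc Var[fun ω => inner ℝ ζ (stepNoise γ (Ξ n ω) (Ξ' n ω)); P]
      = Var[∑ i, X i; P] := by
        congr 1 with ω
        rw [inner_stepNoise, Finset.sum_apply]
    _ = ∑ i, Var[X i; P] :=
        IndepFun.variance_sum (fun i _ => hL2 i) fun i _ j _ hij => hindep.indepFun hij
    _ ≤ ∑ i, 18 * (lam / γ) * (ζ.fst i ^ 2 + ζ.snd i ^ 2) := Finset.sum_le_sum fun i _ =>
        (variance_inner_of_hasLaw_multivariateGaussian (posSemidef_noiseCov hlam.le)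
          (hin.law_coords n i) _).trans_le (dotProduct_noiseWeight_le hγ hlam hlam' ζ i)
    _ = 18 * (lam / γ) * ‖ζ‖ ^ 2 := by
        rw [← Finset.mul_sum, Finset.sum_add_distrib, WithLp.prod_norm_sq_eq_of_L2,
          EuclideanSpace.real_norm_sq_eq, EuclideanSpace.real_norm_sq_eq]

lemma satisfiesLSI_stepNoise [IsProbabilityMeasure P] (hγ : 0 < γ) (hlam : 0 < lam)
    (hlam' : lam * γ ≤ 1 / 2) (hin : IsSchemeInput P γ lam θ₀ V₀ Ξ Ξ') (n : ℕ) :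
    SatisfiesLSI (P.map fun ω => stepNoise γ (Ξ n ω) (Ξ' n ω)) (18 * (lam / γ)) :=
  satisfiesLSI_of_hasGaussianLaw (hasGaussianLaw_stepNoise hin n)
    (variance_inner_stepNoise_le hγ hlam hlam' hin n)

end Noise

/-! ### The recursion -/

section RandomRecursion

variable {Ω α β δ : Type*} [MeasurableSpace Ω] {P : Measure Ω} [MeasurableSpace α]
  [MeasurableSpace β] [MeasurableSpace δ]

lemma indepFun_prodMk_of_indepFun [IsProbabilityMeasure P] {X : Ω → α} {Y : Ω → β} {Z : Ω → δ}
    (hX : Measurable X) (hY : Measurable Y) (hZ : Measurable Z)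
    (hXYZ : IndepFun X (fun ω => (Y ω, Z ω)) P) (hYZ : IndepFun Y Z P) :
    IndepFun (fun ω => (X ω, Y ω)) Z P := by
  have := Measure.isProbabilityMeasure_map (μ := P) hX.aemeasurable
  have := Measure.isProbabilityMeasure_map (μ := P) hY.aemeasurable
  have := Measure.isProbabilityMeasure_map (μ := P) hZ.aemeasurable
  have hXY : IndepFun X Y P := hXYZ.comp measurable_id measurable_fst
  rw [indepFun_iff_map_prod_eq_prod_map_map (by fun_prop) (by fun_prop)] at *
  rw [hYZ, ← Measure.prodAssoc_prod, ← hXY] at hXYZ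
  refine MeasurableEquiv.prodAssoc.map_measurableEquiv_injective (Eq.trans ?_ hXYZ)
  exact Measure.map_map MeasurableEquiv.prodAssoc.measurable (by fun_prop)

lemma indepFun_tail_of_iIndepFun {ξ : ℕ → Ω → β} (hξ : iIndepFun ξ P)
    (hmeas : ∀ n, Measurable (ξ n)) (n : ℕ) :
    IndepFun (ξ n) (fun ω k => ξ (n + 1 + k) ω) P := by
  rw [iIndepFun_iff_iIndep] at hξ
  have hdisj : Disjoint {n} (Set.Ici (n + 1)) := by simp
  have h := indep_iSup_of_disjoint (fun k => (hmeas k).comap_le) hξ hdisj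
  rw [IndepFun_iff_Indep]
  refine indep_of_indep_of_le_left (indep_of_indep_of_le_right h ?_) (by simp)
  rw [MeasurableSpace.pi, MeasurableSpace.comap_iSup]
  refine iSup_le fun k => ?_
  rw [MeasurableSpace.comap_comp]
  exact le_iSup₂_of_le (n + 1 + k) (Nat.le_add_right _ _) le_rfl

variable {Z : ℕ → Ω → α} {ξ : ℕ → Ω → β} {F : α × β → α}

lemma measurable_of_recursion (hF : Measurable F)
    (hZ : ∀ n ω, Z (n + 1) ω = F (Z n ω, ξ n ω)) (hZ₀ : Measurable (Z 0))
    (hξ : ∀ n, Measurable (ξ n)) (n : ℕ) : Measurable (Z n) := by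
  induction n with
  | zero => exact hZ₀
  | succ n ih =>
    rw [funext (hZ n)]
    exact hF.comp (ih.prodMk (hξ n))

lemma indepFun_tail_of_recursion [IsProbabilityMeasure P] (hF : Measurable F)
    (hZ : ∀ n ω, Z (n + 1) ω = F (Z n ω, ξ n ω)) (hZ₀ : Measurable (Z 0))
    (hξ : ∀ n, Measurable (ξ n)) (hinit : IndepFun (Z 0) (fun ω n => ξ n ω) P)
    (hindep : iIndepFun ξ P) (n : ℕ) : IndepFun (Z n) (fun ω k => ξ (n + k) ω) P := by
  induction n with
  | zero => simpa using hinit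
  | succ n ih =>
    have hsplit : IndepFun (Z n) (fun ω => (ξ n ω, fun k => ξ (n + 1 + k) ω)) P := by
      have h := ih.comp measurable_id
        (show Measurable fun s : ℕ → β => (s 0, fun k => s (1 + k)) by fun_prop)
      simpa [Function.comp_def, add_assoc] using h
    rw [funext (hZ n)]
    exact (indepFun_prodMk_of_indepFun (measurable_of_recursion hF hZ hZ₀ hξ n) (hξ n)
      (by fun_prop) hsplit (indepFun_tail_of_iIndepFun hindep hξ n)).comp hF measurable_id

end RandomRecursion

section Scheme

variable {d : ℕ} {Ω : Type*} [MeasurableSpace Ω] {P : Measure Ω} {γ lam m M C₀ : ℝ}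
  {b : EuclideanSpace ℝ (Fin d) → EuclideanSpace ℝ (Fin d)}
  {θ₀ V₀ : Ω → EuclideanSpace ℝ (Fin d)} {Ξ Ξ' : ℕ → Ω → EuclideanSpace ℝ (Fin d)}

/-- One step of the scheme, as a function of the current state and of the noise `(Ξ, Ξ')`. -/
noncomputable def schemeStep (b : EuclideanSpace ℝ (Fin d) → EuclideanSpace ℝ (Fin d)) (γ lam : ℝ)
    (p : (EuclideanSpace ℝ (Fin d) × EuclideanSpace ℝ (Fin d)) ×
      (EuclideanSpace ℝ (Fin d) × EuclideanSpace ℝ (Fin d))) :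
    EuclideanSpace ℝ (Fin d) × EuclideanSpace ℝ (Fin d) :=
  (p.1.1 + psi1 γ lam • p.1.2 - psi2 γ lam • b p.1.1 + √(2 * γ) • p.2.2,
    psi0 γ lam • p.1.2 - psi1 γ lam • b p.1.1 + √(2 * γ) • p.2.1)

lemma measurable_schemeStep (hb : Measurable b) (γ lam : ℝ) : Measurable (schemeStep b γ lam) := by
  unfold schemeStep
  fun_prop

lemma measurable_expScheme (hb : Measurable b) (hin : IsSchemeInput P γ lam θ₀ V₀ Ξ Ξ') (n : ℕ) :
    Measurable (expScheme b γ lam θ₀ V₀ Ξ Ξ' n) :=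
  measurable_of_recursion (measurable_schemeStep hb γ lam) (fun _ _ => rfl)
    (hin.measurable_θ₀.prodMk hin.measurable_V₀)
    (fun k => (hin.measurable_Ξ k).prodMk (hin.measurable_Ξ' k)) n

lemma indepFun_expScheme [IsProbabilityMeasure P] (hb : Measurable b)
    (hin : IsSchemeInput P γ lam θ₀ V₀ Ξ Ξ') (n : ℕ) :
    IndepFun (expScheme b γ lam θ₀ V₀ Ξ Ξ' n) (fun ω => (Ξ n ω, Ξ' n ω)) P :=
  (indepFun_tail_of_recursion (measurable_schemeStep hb γ lam) (fun _ _ => rfl)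
    (hin.measurable_θ₀.prodMk hin.measurable_V₀)
    (fun k => (hin.measurable_Ξ k).prodMk (hin.measurable_Ξ' k)) hin.indep_init hin.indep_steps
    n).comp measurable_id (measurable_pi_apply 0)

lemma measurable_coordM (γ : ℝ) : Measurable (coordM (d := d) γ) :=
  (WithLp.measurable_toLp 2 _).comp (by fun_prop)

lemma measurable_coordM_expScheme (hb : Measurable b)
    (hin : IsSchemeInput P γ lam θ₀ V₀ Ξ Ξ') (n : ℕ) :
    Measurable fun ω => coordM γ (expScheme b γ lam θ₀ V₀ Ξ Ξ' n ω) :=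
  (measurable_coordM γ).comp (measurable_expScheme hb hin n)

lemma measurable_stepNoise (γ : ℝ) :
    Measurable fun p : EuclideanSpace ℝ (Fin d) × EuclideanSpace ℝ (Fin d) =>
      stepNoise γ p.1 p.2 :=
  (WithLp.measurable_toLp 2 _).comp (by fun_prop)

lemma measurable_stepNoise_comp (hin : IsSchemeInput P γ lam θ₀ V₀ Ξ Ξ') (n : ℕ) :
    Measurable fun ω => stepNoise γ (Ξ n ω) (Ξ' n ω) :=
  (measurable_stepNoise γ).comp ((hin.measurable_Ξ n).prodMk (hin.measurable_Ξ' n))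

lemma map_coordM_expScheme_succ [IsProbabilityMeasure P] (hb : Measurable b)
    (hS : Measurable (stepMap b γ lam)) (hγ : γ ≠ 0) (hin : IsSchemeInput P γ lam θ₀ V₀ Ξ Ξ')
    (n : ℕ) :
    (P.map fun ω => coordM γ (expScheme b γ lam θ₀ V₀ Ξ Ξ' (n + 1) ω))
      = ((P.map fun ω => coordM γ (expScheme b γ lam θ₀ V₀ Ξ Ξ' n ω)).map (stepMap b γ lam))
        ∗ (P.map fun ω => stepNoise γ (Ξ n ω) (Ξ' n ω)) := by
  have hZ := measurable_coordM_expScheme hb hin n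
  have hindep : IndepFun
      (fun ω => stepMap b γ lam (coordM γ (expScheme b γ lam θ₀ V₀ Ξ Ξ' n ω)))
      (fun ω => stepNoise γ (Ξ n ω) (Ξ' n ω)) P :=
    (indepFun_expScheme hb hin n).comp (hS.comp (measurable_coordM γ)) (measurable_stepNoise γ)
  rw [Measure.map_map hS hZ, funext (coordM_expScheme_succ b hγ lam θ₀ V₀ Ξ Ξ' n)]
  exact hindep.map_add_eq_map_conv_map (hS.comp hZ) (measurable_stepNoise_comp hin n)

lemma satisfiesLSI_expScheme_succ [IsProbabilityMeasure P] (hb : Measurable b) (hγ : 0 < γ)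
    (hlam : 0 < lam) (hlam' : lam * γ ≤ 1 / 2) {κ : NNReal}
    (hκ : LipschitzWith κ (stepMap b γ lam)) (hin : IsSchemeInput P γ lam θ₀ V₀ Ξ Ξ') {n : ℕ}
    {C : ℝ} (hC : 0 ≤ C)
    (h : SatisfiesLSI (P.map fun ω => coordM γ (expScheme b γ lam θ₀ V₀ Ξ Ξ' n ω)) C) :
    SatisfiesLSI (P.map fun ω => coordM γ (expScheme b γ lam θ₀ V₀ Ξ Ξ' (n + 1) ω))
      (κ ^ 2 * C + 18 * (lam / γ)) := by
  have hS : Measurable (stepMap b γ lam) := hκ.continuous.measurable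
  have := Measure.isProbabilityMeasure_map (μ := P)
    (measurable_coordM_expScheme hb hin n).aemeasurable
  have := Measure.isProbabilityMeasure_map
    (μ := P.map fun ω => coordM γ (expScheme b γ lam θ₀ V₀ Ξ Ξ' n ω)) hS.aemeasurable
  have := Measure.isProbabilityMeasure_map (μ := P) (measurable_stepNoise_comp hin n).aemeasurable
  rw [map_coordM_expScheme_succ hb hS hγ.ne' hin]
  exact (h.map_lipschitz hC hκ).conv (satisfiesLSI_stepNoise hγ hlam hlam' hin n)

lemma satisfiesLSI_expScheme [IsProbabilityMeasure P] (hb : Measurable b) (hm : 0 < m)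
    (hmM : m ≤ M) (hmono : ∀ x y, m * ‖x - y‖ ^ 2 ≤ inner ℝ (b x - b y) (x - y))
    (hcoco : Cocoercive b (6 * M)) (hγ : 0 < γ) (hγM : 25 * M ≤ γ ^ 2) (hlam : 0 < lam)
    (hlam' : lam * γ ≤ 1 / 2) (hin : IsSchemeInput P γ lam θ₀ V₀ Ξ Ξ') (hC₀ : 0 ≤ C₀)
    (h : SatisfiesLSI (P.map fun ω => coordM γ (θ₀ ω, V₀ ω)) C₀) (n : ℕ) :
    SatisfiesLSI (P.map fun ω => coordM γ (expScheme b γ lam θ₀ V₀ Ξ Ξ' n ω))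
      ((1 - m * lam / (5 * γ)) ^ n * C₀ + (1 - (1 - m * lam / (5 * γ)) ^ n) * (90 / m)) := by
  have hlip := lipschitzWith_stepMap hm.le hmM hmono hcoco hγ hγM hlam hlam'
  obtain ⟨hρ₀, hρ₁⟩ := one_sub_mul_div_mem_Icc hm.le hγ (by linarith) hlam hlam'
  set ρ := 1 - m * lam / (5 * γ)
  induction n with
  | zero => simpa [expScheme] using h
  | succ n ih =>
    have hC : 0 ≤ ρ ^ n * C₀ + (1 - ρ ^ n) * (90 / m) :=
      add_nonneg (by positivity)
        (mul_nonneg (sub_nonneg.2 (pow_le_one₀ hρ₀ hρ₁)) (by positivity))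
    have hnoise : 18 * (lam / γ) = (1 - ρ) * (90 / m) := by
      simp only [ρ]
      field_simp
      ring
    convert satisfiesLSI_expScheme_succ hb hγ hlam hlam' hlip hin hC ih using 1
    rw [Real.coe_toNNReal _ (Real.sqrt_nonneg _), Real.sq_sqrt hρ₀, hnoise]
    ring

end Scheme

lemma one_sub_pow_mul_add_le {m γ lam C₀ : ℝ} (hm : 0 < m) (hγ : 0 < γ) (hlam : 0 < lam)
    (hC₀ : 0 ≤ C₀) (hρ : 0 ≤ 1 - m * lam / (5 * γ)) (n : ℕ) :
    (1 - m * lam / (5 * γ)) ^ n * C₀ + (1 - (1 - m * lam / (5 * γ)) ^ n) * (90 / m)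
      ≤ (1 - 1 / 90 * m / γ * lam) ^ n * C₀ + 1 / (1 / 90 * m) := by
  have hrate : 1 / 90 * m / γ * lam ≤ m * lam / (5 * γ) := by
    rw [show 1 / 90 * m / γ * lam = m * lam / (5 * γ) / 18 by field_simp; norm_num]
    exact div_le_self (by positivity) (by norm_num)
  have hconst : 1 / (1 / 90 * m) = 90 / m := by field_simp
  rw [hconst]
  exact add_le_add
    (mul_le_mul_of_nonneg_right (pow_le_pow_left₀ hρ (by linarith) n) hC₀)
    (mul_le_of_le_one_left (by positivity) (sub_le_self _ (pow_nonneg hρ n)))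

lemma nonneg_of_satisfiesLSI_map_coordM {d : ℕ} [NeZero d] {Ω : Type*} [MeasurableSpace Ω]
    {P : Measure Ω} [IsProbabilityMeasure P] {γ C : ℝ}
    {Z : Ω → EuclideanSpace ℝ (Fin d) × EuclideanSpace ℝ (Fin d)} (hZ : Measurable Z)
    (h : SatisfiesLSI (P.map fun ω => coordM γ (Z ω)) C) : 0 ≤ C := by
  have : IsProbabilityMeasure (P.map fun ω => coordM γ (Z ω)) :=
    Measure.isProbabilityMeasure_map ((measurable_coordM γ).comp hZ).aemeasurable
  exact h.nonneg

end TamedKinetic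

open TamedKinetic in
theorem mainTheorem4 :
    ∃ c₀ : ℝ, 0 < c₀ ∧ ∃ K : ℝ, 0 ≤ K ∧
      ∀ (d : ℕ) (_hd : 0 < d) (u : EuclideanSpace ℝ (Fin d) → ℝ) (m L l : ℝ),
        Differentiable ℝ u → 0 < m → 0 < L → 0 < l →
        StronglyMonotone (gradient u) m → PolyLipschitz (gradient u) L l →
      ∀ γ lam : ℝ, 0 < γ → 0 < lam →
        5 * √(lipConst (tamedDrift (gradient u) m L l lam)) ≤ γ → lam ≤ 1 / (2 * γ) →
      ∀ (Ω : Type*) [MeasurableSpace Ω] (P : Measure Ω) [IsProbabilityMeasure P]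
        (θ₀ V₀ : Ω → EuclideanSpace ℝ (Fin d)) (Ξ Ξ' : ℕ → Ω → EuclideanSpace ℝ (Fin d)),
        IsSchemeInput P γ lam θ₀ V₀ Ξ Ξ' →
      ∀ C₀ : ℝ, SatisfiesLSI (P.map fun ω => coordM γ (θ₀ ω, V₀ ω)) C₀ →
      ∀ n : ℕ, ∃ C : ℝ,
        C ≤ (1 - c₀ * m / γ * lam) ^ n * C₀ + 1 / (c₀ * m) + K * (lam * γ) ∧
        SatisfiesLSI
          (P.map fun ω => coordM γ
            (expScheme (tamedDrift (gradient u) m L l lam) γ lam θ₀ V₀ Ξ Ξ' n ω)) C := by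
  refine ⟨1 / 90, by norm_num, 0, le_rfl, ?_⟩
  intro d hd u m L l hu hm hL hl hmono hpoly γ lam hγ hlam hγM hlamγ Ω _ P _ θ₀ V₀ Ξ Ξ' hin C₀
    hLSI n
  have : NeZero d := ⟨hd.ne'⟩
  have hlip := lipschitzWith_tamedDrift hm hL hl.le hlam hpoly
  have hmM := le_lipConst_tamedDrift hm hL hl.le hlam hpoly
  have hcoco := cocoercive_tamedDrift hu hm hL hl.le hlam hmono hpoly
  have hdrift := stronglyMonotone_tamedDrift hu hm hL hl.le hlam hmono hpoly
  simp only [StronglyMonotone, mul_div_cancel₀ m two_ne_zero] at hdrift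
  set b := tamedDrift (gradient u) m L l lam
  have hγ₂ : 25 * (lipConst b : ℝ) ≤ γ ^ 2 := by
    linarith [(Real.sqrt_le_iff.1 (show √(lipConst b) ≤ γ / 5 by linarith)).2]
  have hlam' : lam * γ ≤ 1 / 2 := by
    rw [le_div_iff₀ (by positivity)] at hlamγ
    linarith
  have hC₀ : 0 ≤ C₀ :=
    nonneg_of_satisfiesLSI_map_coordM (hin.measurable_θ₀.prodMk hin.measurable_V₀) hLSI
  refine ⟨_, ?_, satisfiesLSI_expScheme hlip.continuous.measurable hm hmM hdrift hcoco hγ hγ₂ hlam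
    hlam' hin hC₀ hLSI n⟩
  rw [zero_mul, add_zero]
  exact one_sub_pow_mul_add_le hm hγ hlam hC₀
    (one_sub_mul_div_mem_Icc hm.le hγ (by linarith) hlam hlam').1 n
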